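/- **Election model.** There are candidates $c_0,\dots,c_\ell$ and a finite directed network $(V,E,p)$ of voters with influence strengths $p:V\times V\to[0,1]$ (rational); every voter $v$ has a score function $\pi_v:\{c_0,\dots,c_\ell\}\to\mathbb N$, which is injective and otherwise arbitrary. A solution is a set $S\subseteq V$ of seeds with messages $m_s\in\mathbb Z^{\ell+1}$, $s\in S$; its cost is $|M|=\sum_{s\in S}\sum_i|m_s(i)|$. It has *single-news-article messages* if all seeds send the same message and this message is $+1$ or $-1$ on one candidate and $0$ on the others. In the random live graph $H\subseteq E$ every edge $e\in E$ is kept independently with probability $p(e)$. The message of $s$ activates $s$ at time $0$, and at time $t\ge 1$ it activates the voters not activated by it before that have an edge of $H$ from a voter activated by it at time $t-1$. If $R_v\subseteq S$ is the set of seeds whose message activates $v$ at some time, the score of $c_i$ for $v$ becomes $(1-\epsilon)\pi_v(i)+\sum_{s\in R_v}m_s(i)$ with $\epsilon=1/(1+\max_{v,i}\pi_v(i))$ (so ties are broken in favour of the candidate ranked last initially), and $v$ votes for the candidate with the highest score. $\mathsf{MoV}(S,M,H)$ is the number of votes of $c_0$ minus the maximum number of votes of another candidate. **ECS** (Election-Control-by-Seeding)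 *with single-news-article messages and two candidates*: given such a scenario with $\ell=1$ and a budget $B\in\mathbb N$, find $(S,M)$ with single-news-article messages and $|M|\le B$ that maximizes $\mathbb E_H[\mathsf{MoV}(S,M,H)-\mathsf{MoV}(\emptyset,\emptyset,H)]$. **DkS** (Densest-$k$-Subgraph): given a finite simple undirected graph $G=(X,N)$ and $k\le |X|$, find a set of exactly $k$ vertices that maximizes the number of edges of the subgraph it induces. A *$\rho$-approximation algorithm* for either problem is a polynomial-time algorithm (a Turing machine whose running time is polynomial in the length of the binary encoding of the instance) that returns, on every instance, a feasible solution whose value is at least $\rho$ times the value of every feasible solution. **Theorem.** For every real constant $\rho>0$: if there is a $\rho$-approximation algorithm for ECS with single-news-article messages, two candidates and arbitrary scores, then there is a $\rho$-approximation algorithm for DkS. Consequently, if DkS has no $\rho$-approximation algorithm for any constant $\rho>0$, then neither has ECS with single-news-article messages, two candidates and arbitrary scores. -/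

import Mathlib

namespace ElectionControl

/-! ### Elections on a social network -/

/-- An election scenario with candidates `c_0, …, c_ℓ` (`c_0` is the manipulator's candidate) and
voters `0, …, n - 1`. `E` is the set of directed edges and `p (u, v)` the strength of the influence
of `u` on `v`, a rational number so that a scenario is a finite object; `π v` assigns to the
candidates the pairwise distinct, otherwise arbitrary, scores of voter `v`. -/
structure Election (ℓ : ℕ) where
  n : ℕ
  E : Finset (Fin n × Fin n)
  p : Fin n × Fin n → ℚ
  p_nonneg : ∀ e, 0 ≤ p e
  p_le_one : ∀ e, p e ≤ 1
  π : Fin n → Fin (ℓ + 1) → ℕ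
  π_injective : ∀ v, Function.Injective (π v)

/-- A choice of seeds and messages among `n` voters: `P v = none` if `v` is not a seed, and
`P v = some m` if `v` is a seed with message `m`, where `m i` counts the news articles on `c_i`
sent by `v` (positive articles if `m i > 0`, negative ones if `m i < 0`). -/
abbrev SeedPlan (ℓ n : ℕ) : Type := Fin n → Option (Fin (ℓ + 1) → ℤ)

namespace SeedPlan

variable {ℓ n : ℕ}

/-- No seeds and no messages. -/
def empty : SeedPlan ℓ n := fun _ => none

/-- The information that `s` sends on `c_i`; it is `0` if `s` is not a seed. -/
def info (P : SeedPlan ℓ n) (s : Fin n) (i : Fin (ℓ + 1)) : ℤ :=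
  match P s with
  | none => 0
  | some m => m i

/-- The total number `|M|` of news articles sent by the seeds. -/
def cost (P : SeedPlan ℓ n) : ℕ := ∑ s, ∑ i, (P.info s i).natAbs

/-- Single-news-article messages: all seeds send the same message, which consists of one positive
or one negative news article on one candidate. -/
def IsSingleNews (P : SeedPlan ℓ n) : Prop :=
  ∃ (j : Fin (ℓ + 1)) (q : ℤ), (q = 1 ∨ q = -1) ∧ ∀ s m, P s = some m → m = Pi.single j q

end SeedPlan

/-- Diffusion in the live graph `H` of the message of the seed `s`. The first component at time `t`
is the set of voters that become active at time `t`, the second one is the set of voters that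
became active at some time `≤ t`. -/
def cascade {n : ℕ} (H : Finset (Fin n × Fin n)) (s : Fin n) :
    ℕ → Finset (Fin n) × Finset (Fin n)
  | 0 => ({s}, {s})
  | t + 1 =>
    let A : Finset (Fin n) := {v | v ∉ (cascade H s t).2 ∧ ∃ u ∈ (cascade H s t).1, (u, v) ∈ H}
    (A, (cascade H s t).2 ∪ A)

/-- In the live graph `H`, the voter `v` is activated by the message of `s` at some time. -/
def IsInfluenced {n : ℕ} (H : Finset (Fin n × Fin n)) (s v : Fin n) : Prop :=
  ∃ t, v ∈ (cascade H s t).1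

namespace Election

variable {ℓ : ℕ} (I : Election ℓ)

/-- The perturbation parameter of the tie-breaking rule, `1 / (1 + max_{v,i} π_v(i))`. -/
def ε : ℚ := 1 / (1 + ((Finset.univ.sup fun v => Finset.univ.sup (I.π v) : ℕ) : ℚ))

open Classical in
/-- The score that voter `v` gives to `c_i` after the diffusion and the preference revision.
The factor `1 - ε` breaks ties in favour of the candidate that was ranked last initially. -/
noncomputable def revisedScore (P : SeedPlan ℓ I.n) (H : Finset (Fin I.n × Fin I.n))
    (v : Fin I.n) (i : Fin (ℓ + 1)) : ℚ :=
  (1 - I.ε) * I.π v i + ∑ s with IsInfluenced H s v, (P.info s i : ℚ)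

open Classical in
/-- The voters that rank `c` first after the preference revision. -/
noncomputable def supporters (P : SeedPlan ℓ I.n) (H : Finset (Fin I.n × Fin I.n))
    (c : Fin (ℓ + 1)) : Finset (Fin I.n) :=
  {v | ∀ j, j ≠ c → I.revisedScore P H v j < I.revisedScore P H v c}

/-- The margin of victory of `c_0`. -/
noncomputable def MoV (P : SeedPlan ℓ I.n) (H : Finset (Fin I.n × Fin I.n)) : ℤ :=
  ((I.supporters P H 0).card : ℤ) -
    (((Finset.univ.filter (· ≠ 0)).sup fun c => (I.supporters P H c).card : ℕ) : ℤ)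

/-- The probability that the live graph is `H`: every edge `e` of the network is kept with
probability `p e`, independently. -/
def liveProb (H : Finset (Fin I.n × Fin I.n)) : ℚ :=
  ∏ e ∈ I.E, if e ∈ H then I.p e else 1 - I.p e

/-- The expected increase of the margin of victory of `c_0` caused by the seeds. -/
noncomputable def expectedGain (P : SeedPlan ℓ I.n) : ℚ :=
  ∑ H ∈ I.E.powerset, I.liveProb H * ((I.MoV P H - I.MoV SeedPlan.empty H : ℤ) : ℚ)

end Election

/-! ### The two optimization problems -/

/-- An instance of Election-Control-by-Seeding: an election scenario and a budget. -/
structure ECSInstance (ℓ : ℕ) extends Election ℓ where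
  B : ℕ

/-- Feasible solutions of an ECS instance in the setting with single-news-article messages. -/
def ECSInstance.Feasible {ℓ : ℕ} (I : ECSInstance ℓ) (P : SeedPlan ℓ I.n) : Prop :=
  P.IsSingleNews ∧ P.cost ≤ I.B

/-- An instance of Densest-`k`-Subgraph. -/
structure DkSInstance where
  n : ℕ
  G : SimpleGraph (Fin n)
  k : ℕ
  k_le : k ≤ n

/-- The number of edges of the subgraph induced by `X`. -/
noncomputable def DkSInstance.density (I : DkSInstance) (X : Finset (Fin I.n)) : ℕ :=
  (I.G.induce (X : Set (Fin I.n))).edgeSet.ncard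

/-! ### Encodings as strings over the alphabet `{0, 1, #}` (where `none` is the separator `#`) -/

/-- A list of natural numbers is written in binary, each number followed by a separator. -/
def encodeNats (l : List ℕ) : List (Option Bool) :=
  l.flatMap fun a => (Computability.encodeNat a).map some ++ [none]

/-- The number of voters, the budget, for each pair of voters whether it is an edge together with
the numerator and the denominator of its strength, and the scores. -/
def encodeECSInstance {ℓ : ℕ} (I : ECSInstance ℓ) : List (Option Bool) :=
  encodeNats <|
    [I.n, I.B] ++
    ((List.finRange I.n).flatMap fun u => (List.finRange I.n).flatMap fun v =>
      [if (u, v) ∈ I.E then 1 else 0, (I.p (u, v)).num.toNat, (I.p (u, v)).den]) ++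
    ((List.finRange I.n).flatMap fun v => (List.finRange (ℓ + 1)).map fun i => I.π v i)

/-- The number of voters and, for each voter, `0` if it is not a seed, and otherwise `1` followed
by its message (an integer is coded by a natural number: `m ≥ 0` by `2 m`, and `m < 0` by
`-2 m - 1`). -/
def encodeSeedPlan {ℓ : ℕ} (x : Σ n, SeedPlan ℓ n) : List (Option Bool) :=
  encodeNats <|
    x.1 :: (List.finRange x.1).flatMap fun s =>
      match x.2 s with
      | none => [0]
      | some m => 1 :: (List.finRange (ℓ + 1)).map fun i => Equiv.intEquivNat (m i)

open Classical in
/-- The number of vertices, the number `k` and the adjacency matrix. -/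
noncomputable def encodeDkSInstance (I : DkSInstance) : List (Option Bool) :=
  encodeNats <|
    [I.n, I.k] ++
    ((List.finRange I.n).flatMap fun u => (List.finRange I.n).map fun v =>
      if I.G.Adj u v then 1 else 0)

/-- The number of vertices and the characteristic vector of the set. -/
def encodeVertexSet (x : Σ n, Finset (Fin n)) : List (Option Bool) :=
  encodeNats <| x.1 :: (List.finRange x.1).map fun v => if v ∈ x.2 then 1 else 0

/-! ### Polynomial-time approximation algorithms -/

/-- There is a polynomial-time `ρ`-approximation algorithm for ECS with single-news-article
messages and `ℓ + 1` candidates (and arbitrary scores). -/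
def ECSSingleNewsApproximable (ℓ : ℕ) (ρ : ℝ) : Prop :=
  ∃ A : (I : ECSInstance ℓ) → SeedPlan ℓ I.n,
    (∀ I : ECSInstance ℓ, I.Feasible (A I) ∧
      ∀ P : SeedPlan ℓ I.n, I.Feasible P → ρ * (I.expectedGain P : ℝ) ≤ (I.expectedGain (A I) : ℝ)) ∧
    Nonempty (Turing.TM2ComputableInPolyTime encodeECSInstance encodeSeedPlan
      fun I : ECSInstance ℓ => (⟨I.n, A I⟩ : Σ n, SeedPlan ℓ n))

/-- There is a polynomial-time `ρ`-approximation algorithm for Densest-`k`-Subgraph. -/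
def DkSApproximable (ρ : ℝ) : Prop :=
  ∃ A : (I : DkSInstance) → Finset (Fin I.n),
    (∀ I : DkSInstance, (A I).card = I.k ∧
      ∀ X : Finset (Fin I.n), X.card = I.k → ρ * (I.density X : ℝ) ≤ (I.density (A I) : ℝ)) ∧
    Nonempty (Turing.TM2ComputableInPolyTime encodeDkSInstance encodeVertexSet
      fun I : DkSInstance => (⟨I.n, A I⟩ : Σ n, Finset (Fin n)))

end ElectionControl

/-! The reduction turns a graph on `n` vertices into an election whose voters are the ordered pairs
of vertices. The diagonal voter `(a, a)` influences every pair containing `a`, with certainty. An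
off-diagonal voter `(a, b)` is therefore reached exactly by seeds among `(a, a)`, `(b, b)` and `(a,
b)`. If `a` and `b` are adjacent, `(a, b)` starts with scores `0` and `2`; as `ε = 1/3`, it trails
for `c_0` by `4/3`, so one favourable message is not enough, two are, and a tie is impossible. All
other voters already vote for `c_0`.

Seeding the diagonal voters of a set `X` wins both orientations of each edge inside `X`. Every won
voter changes the margin by two, so the gain is at least four times the number of edges
(`le_expectedGain_planOf`). Conversely, a voter `(a, b)` won by an arbitrary plan has two seeds
among `(a, a)`, `(b, b)`, `(a, b)`. The set `chosen` is made so that this puts both `a` and `b` in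
it (`mem_chosen_of_two_le_received`), while it has no more elements than there are seeds
(`card_chosen_le`); hence `expectedGain_le`. Padding `chosen` to `k` vertices loses no edges, so the
factor four cancels and the ratio `ρ` survives unchanged (`density_finalSet`).

The rest shows that both translations take polynomial time on an actual Turing machine that uses the
given one as a subroutine. A small structured language over stacks has a big-step semantics with
time bounds (`Exec`) and a compiler to multi-stack machines, proved correct in `Exec.stepsTo` and
`Exec.machine_outputs`. Its `call` runs the given machine on stacks of its own. The programs
`reductionProg` and `extractionProg` are verified in `exec_reductionProg` and `exec_extractionProg`.
Their times are polynomials in `n`, and `n` is at most the input length because the input spells out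
the adjacency matrix. -/

namespace StackProgram

/-! ### A structured stack language with an external call, and its compilation to Turing machines.
-/

open Turing Function

/-! ### Counted runs of a transition system -/

/-- `f` leads from `a` to `b` in exactly `n` steps. -/
def StepsTo {σ : Type*} (f : σ → Option σ) (n : ℕ) (a b : σ) : Prop :=
  (flip bind f)^[n] (some a) = some b

theorem StepsTo.refl {σ : Type*} (f : σ → Option σ) (a : σ) : StepsTo f 0 a a := rfl

theorem StepsTo.head {σ : Type*} {f : σ → Option σ} {n : ℕ} {a b c : σ} (h : f a = some b)
    (h' : StepsTo f n b c) : StepsTo f (n + 1) a c := by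
  unfold StepsTo
  rw [iterate_succ_apply]
  change (flip bind f)^[n] (f a) = some c
  rw [h]
  exact h'

theorem StepsTo.single {σ : Type*} {f : σ → Option σ} {a b : σ} (h : f a = some b) :
    StepsTo f 1 a b :=
  StepsTo.head h (StepsTo.refl f b)

theorem StepsTo.trans {σ : Type*} {f : σ → Option σ} {m n : ℕ} {a b c : σ}
    (h : StepsTo f m a b) (h' : StepsTo f n b c) : StepsTo f (m + n) a c := by
  unfold StepsTo at *
  rw [add_comm, iterate_add_apply, h, h']

theorem iterate_flip_bind_none {σ : Type*} (f : σ → Option σ) (n : ℕ) :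
    (flip bind f)^[n] none = none := by
  induction n with
  | zero => rfl
  | succ n ih => rw [iterate_succ_apply]; exact ih

theorem StepsTo.cases_head {σ : Type*} {f : σ → Option σ} {n : ℕ} {a c : σ}
    (h : StepsTo f (n + 1) a c) : ∃ b, f a = some b ∧ StepsTo f n b c := by
  unfold StepsTo at h
  rw [iterate_succ_apply] at h
  change (flip bind f)^[n] (f a) = some c at h
  cases hf : f a with
  | none => rw [hf, iterate_flip_bind_none] at h; cases h
  | some b => exact ⟨b, rfl, by rwa [hf] at h⟩

/-! ### Structured programs over stacks -/

/-- Structured programs over stacks with indices in `K` and symbols in `Γ`. `branch` looks at the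
top symbol of a stack, `loop` pops symbols from a stack until it is empty, and runs its body after
each of them. `call i o` runs an external machine. -/
inductive Prog (K Γ : Type) : Type
  | skip : Prog K Γ
  | push (k : K) (a : Γ) : Prog K Γ
  | pop (k : K) : Prog K Γ
  | seq (p q : Prog K Γ) : Prog K Γ
  | branch (k : K) (b : Option Γ → Prog K Γ) : Prog K Γ
  | loop (k : K) (b : Γ → Prog K Γ) : Prog K Γ
  | call (i o : K) : Prog K Γ

infixr:60 " ;; " => Prog.seq

section Semantics

variable {K Γ : Type} [DecidableEq K]

/-- `Exec R p s s' t`: the program `p` leads from the stacks `s` to the stacks `s'` in time at most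
`t`, if the external machine turns `x` into `y` in time `t'` whenever `R x y t'`. -/
inductive Exec (R : List Γ → List Γ → ℕ → Prop) :
    Prog K Γ → (K → List Γ) → (K → List Γ) → ℕ → Prop
  | skip {s} : Exec R .skip s s 1
  | push {k a s} : Exec R (.push k a) s (update s k (a :: s k)) 1
  | pop {k s} : Exec R (.pop k) s (update s k (s k).tail) 1
  | seq {p q s s' s'' t t'} : Exec R p s s' t → Exec R q s' s'' t' →
      Exec R (.seq p q) s s'' (t + t')
  | branch {k b s s' t} : Exec R (b (s k).head?) s s' t → Exec R (.branch k b) s s' (t + 1)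
  | loop_nil {k b s} : s k = [] → Exec R (.loop k b) s s 1
  | loop_cons {k b s s' s'' x xs t t'} : s k = x :: xs → Exec R (b x) (update s k xs) s' t →
      Exec R (.loop k b) s' s'' t' → Exec R (.loop k b) s s'' (t + t' + 1)
  | call {i o s x y t} : R x y t → s i = x.reverse →
      Exec R (.call i o) s (update (update s i []) o (y.reverse ++ update s i [] o))
        (x.length + t + y.length + 2)
  | mono {p s s' t t'} : Exec R p s s' t → t ≤ t' → Exec R p s s' t'

theorem Exec.of_eq {R : List Γ → List Γ → ℕ → Prop} {p : Prog K Γ} {s s' s'' : K → List Γ}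
    {t t' : ℕ} (h : Exec R p s s' t) (hs : s' = s'') (ht : t ≤ t') : Exec R p s s'' t' :=
  hs ▸ h.mono ht

theorem Exec.of_start_eq {R : List Γ → List Γ → ℕ → Prop} {p : Prog K Γ}
    {s s' s'' : K → List Γ} {t : ℕ} (h : Exec R p s s' t) (hs : s'' = s) : Exec R p s'' s' t :=
  hs ▸ h

end Semantics

/-! ### Compilation -/

section Compile

variable {K Γ : Type} (M : FinTM2)

/-- The labels of the compiled program. -/
inductive Label : Prog K Γ → Type
  | skip : Label .skip
  | push {k a} : Label (.push k a)
  | pop {k} : Label (.pop k)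
  | seqLeft {p q} (l : Label p) : Label (.seq p q)
  | seqRight {p q} (l : Label q) : Label (.seq p q)
  | branchHead {k b} : Label (.branch k b)
  | branchBody {k b} (o : Option Γ) (l : Label (b o)) : Label (.branch k b)
  | loopHead {k b} : Label (.loop k b)
  | loopBody {k b} (x : Γ) (l : Label (b x)) : Label (.loop k b)
  | callLoad {i o} : Label (.call i o)
  | callRun {i o} (l : M.Λ) : Label (.call i o)
  | callUnload {i o} : Label (.call i o)

/-- A branch or loop carries a separate copy of the labels of its body for each symbol that may be
read, so finiteness of the alphabet is what keeps the label set finite. -/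
instance finite_label [Finite Γ] (p : Prog K Γ) : Finite (Label M p) := by
  induction p with
  | skip => exact Finite.of_surjective (fun _ : Unit => .skip) fun l => by cases l; simp
  | push => exact Finite.of_surjective (fun _ : Unit => .push) fun l => by cases l; simp
  | pop => exact Finite.of_surjective (fun _ : Unit => .pop) fun l => by cases l; simp
  | seq p q hp hq =>
    refine Finite.of_surjective (Sum.elim .seqLeft .seqRight) fun l => ?_
    cases l <;> simp
  | branch k b h =>
    refine Finite.of_surjective (fun x : Option (Σ o, Label M (b o)) =>
      x.elim .branchHead fun y => .branchBody y.1 y.2) fun l => ?_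
    cases l with
    | branchHead => exact ⟨none, rfl⟩
    | branchBody o l => exact ⟨some ⟨o, l⟩, rfl⟩
  | loop k b h =>
    refine Finite.of_surjective (fun x : Option (Σ o, Label M (b o)) =>
      x.elim .loopHead fun y => .loopBody y.1 y.2) fun l => ?_
    cases l with
    | loopHead => exact ⟨none, rfl⟩
    | loopBody o l => exact ⟨some ⟨o, l⟩, rfl⟩
  | call =>
    have := M.ΛFin
    refine Finite.of_surjective (fun x : Option (Option M.Λ) =>
      x.elim .callLoad fun y => y.elim .callUnload .callRun) fun l => ?_
    cases l with
    | callLoad => exact ⟨none, rfl⟩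
    | callUnload => exact ⟨some none, rfl⟩
    | callRun l => exact ⟨some (some l), rfl⟩

/-- The label at which the execution of a program starts. -/
def start : (p : Prog K Γ) → Label M p
  | .skip => .skip
  | .push _ _ => .push
  | .pop _ => .pop
  | .seq p _ => .seqLeft (start p)
  | .branch _ _ => .branchHead
  | .loop _ _ => .loopHead
  | .call _ _ => .callLoad

variable (K Γ) in
/-- The alphabets of the stacks of the compiled program. -/
abbrev Alph : K ⊕ M.K → Type
  | Sum.inl _ => Γ
  | Sum.inr k => M.Γ k

variable (Γ) in
/-- The states of the compiled program: the symbol read last and the state of the external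
machine. -/
abbrev Reg : Type := Option Γ × M.σ

/-- A statement of the external machine, executed on its part of the memory. Instead of halting,
it jumps to the label `exit`. -/
def liftStmt {Λ : Type} (emb : M.Λ → Λ) (exit : Λ) :
    TM2.Stmt M.Γ M.Λ M.σ → TM2.Stmt (Alph K Γ M) Λ (Reg Γ M)
  | .push k f q => .push (Sum.inr k) (fun v => f v.2) (liftStmt emb exit q)
  | .peek k f q => .peek (Sum.inr k) (fun v o => (v.1, f v.2 o)) (liftStmt emb exit q)
  | .pop k f q => .pop (Sum.inr k) (fun v o => (v.1, f v.2 o)) (liftStmt emb exit q)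
  | .load f q => .load (fun v => (v.1, f v.2)) (liftStmt emb exit q)
  | .branch f q q' => .branch (fun v => f v.2) (liftStmt emb exit q) (liftStmt emb exit q')
  | .goto f => .goto fun v => emb (f v.2)
  | .halt => .goto fun _ => exit

/-- The stacks of the compiled program. -/
def join (s : K → List Γ) (S : ∀ k, List (M.Γ k)) : ∀ k, List (Alph K Γ M k)
  | Sum.inl k => s k
  | Sum.inr k => S k

@[simp] theorem join_inl (s : K → List Γ) (S : ∀ k, List (M.Γ k)) (k : K) :
    join M s S (Sum.inl k) = s k := rfl

@[simp] theorem join_inr (s : K → List Γ) (S : ∀ k, List (M.Γ k)) (k : M.K) :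
    join M s S (Sum.inr k) = S k := rfl

theorem join_nil : join M (fun _ : K => ([] : List Γ)) (fun _ => []) = fun _ => [] := by
  funext k
  cases k <;> rfl

variable [DecidableEq K]

@[simp] theorem update_join_inl (s : K → List Γ) (S : ∀ k, List (M.Γ k)) (k : K) (x : List Γ) :
    update (join M s S) (Sum.inl k) x = join M (update s k x) S := by
  funext j
  rcases j with j | j
  · by_cases h : j = k
    · subst h; simp
    · rw [update_of_ne (by simpa using h), join_inl, join_inl, update_of_ne h]
  · rw [update_of_ne (by simp)]; rfl

@[simp] theorem update_join_inr (s : K → List Γ) (S : ∀ k, List (M.Γ k)) (k : M.K)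
    (x : List (M.Γ k)) :
    update (join M s S) (Sum.inr k) x = join M s (update S k x) := by
  funext j
  rcases j with j | j
  · rw [update_of_ne (by simp)]; rfl
  · by_cases h : j = k
    · subst h; simp
    · rw [update_of_ne (by simpa using h), join_inr, join_inr, update_of_ne h]

/-- The configuration of the whole machine that corresponds to one of the external machine. -/
def liftCfg {Λ : Type} (emb : M.Λ → Λ) (exit : Λ) (r : Option Γ) (s : K → List Γ) (c : M.Cfg) :
    TM2.Cfg (Alph K Γ M) Λ (Reg Γ M) :=
  ⟨some (c.l.elim exit emb), (r, c.var), join M s c.stk⟩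

/-- A lifted statement acts only on the stacks `Sum.inr _` and on the second component of the
register, so `r` and `s` are carried along unchanged. -/
theorem stepAux_liftStmt {Λ : Type} (emb : M.Λ → Λ) (exit : Λ) (r : Option Γ) (s : K → List Γ)
    (q : TM2.Stmt M.Γ M.Λ M.σ) (v : M.σ) (S : ∀ k, List (M.Γ k)) :
    TM2.stepAux (liftStmt M emb exit q) (r, v) (join M s S) =
      liftCfg M emb exit r s (TM2.stepAux q v S) := by
  induction q generalizing v S with
  | push k f q ih =>
    simp only [liftStmt, TM2.stepAux]
    rw [← ih]; congr 1; exact update_join_inr M s S k _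
  | peek k f q ih => simp only [liftStmt, TM2.stepAux, join_inr]; exact ih _ _
  | pop k f q ih =>
    simp only [liftStmt, TM2.stepAux]
    rw [← ih]; congr 1; exact update_join_inr M s S k _
  | load f q ih => simp only [liftStmt, TM2.stepAux]; exact ih _ _
  | branch f q q' ih ih' =>
    simp only [liftStmt, TM2.stepAux]
    cases f v
    · exact ih' _ _
    · exact ih _ _
  | goto f => rfl
  | halt => rfl

/-- The simulation is step for step: halting becomes a jump and costs nothing extra, and a halted
configuration has no successor to be simulated. -/
theorem stepsTo_liftCfg {Λ : Type} {m : Λ → TM2.Stmt (Alph K Γ M) Λ (Reg Γ M)} (emb : M.Λ → Λ)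
    (exit : Λ) (hm : ∀ l, m (emb l) = liftStmt M emb exit (M.m l)) (r : Option Γ)
    (s : K → List Γ) {n : ℕ} {c c' : M.Cfg} (h : StepsTo M.step n c c') :
    StepsTo (TM2.step m) n (liftCfg M emb exit r s c) (liftCfg M emb exit r s c') := by
  induction n generalizing c with
  | zero =>
    cases (Option.some_injective _ (show some c = some c' from h))
    exact StepsTo.refl _ _
  | succ n ih =>
    obtain ⟨b, hb, hbc⟩ := h.cases_head
    refine StepsTo.head ?_ (ih hbc)
    obtain ⟨l, v, S⟩ := c
    cases l with
    | none => simp [TM2.step] at hb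
    | some l =>
      obtain rfl : TM2.stepAux (M.m l) v S = b := Option.some_injective _ hb
      change some (TM2.stepAux (m (emb l)) (r, v) (join M s S)) = _
      rw [hm, stepAux_liftStmt]

theorem initList_stk (tm : FinTM2) (l : List (tm.Γ tm.k₀)) :
    (initList tm l).stk = update (fun _ => []) tm.k₀ l := by
  funext k
  by_cases h : k = tm.k₀
  · subst h; simp [initList]
  · simp [initList, h]

theorem haltList_stk (tm : FinTM2) (l : List (tm.Γ tm.k₁)) :
    (haltList tm l).stk = update (fun _ => []) tm.k₁ l := by
  funext k
  by_cases h : k = tm.k₁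
  · subst h; simp [haltList]
  · simp [haltList, h]

variable [Inhabited Γ] (ein : M.Γ M.k₀ ≃ Γ) (eout : M.Γ M.k₁ ≃ Γ)

/-- The statements of the compiled program, for an embedding `emb` of its labels into the labels
of the whole machine and a label `exit` at which the execution goes on afterwards. -/
def code : (p : Prog K Γ) → {Λ : Type} → (Label M p → Λ) → Λ → Label M p →
    TM2.Stmt (Alph K Γ M) Λ (Reg Γ M)
  | .skip, _, _, exit, _ => .goto fun _ => exit
  | .push k a, _, _, exit, _ => .push (Sum.inl k) (fun _ => a) <| .goto fun _ => exit
  | .pop k, _, _, exit, _ => .pop (Sum.inl k) (fun v _ => v) <| .goto fun _ => exit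
  | .seq p q, _, emb, _, .seqLeft l =>
    code p (fun l => emb (.seqLeft l)) (emb (.seqRight (start M q))) l
  | .seq _ q, _, emb, exit, .seqRight l => code q (fun l => emb (.seqRight l)) exit l
  | .branch k b, _, emb, _, .branchHead =>
    .peek (Sum.inl k) (fun v o => (o, v.2)) <|
      .goto fun v => emb (.branchBody v.1 (start M (b v.1)))
  | .branch _ b, _, emb, exit, .branchBody o l =>
    code (b o) (fun l => emb (.branchBody o l)) exit l
  | .loop k b, _, emb, exit, .loopHead =>
    .pop (Sum.inl k) (fun v o => (o, v.2)) <| .goto fun v =>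
      v.1.elim exit fun x => emb (.loopBody x (start M (b x)))
  | .loop _ b, _, emb, _, .loopBody x l =>
    code (b x) (fun l => emb (.loopBody x l)) (emb .loopHead) l
  | .call i _, _, emb, _, .callLoad =>
    .pop (Sum.inl i) (fun v o => (o, v.2)) <| .branch (fun v => v.1.isSome)
      (.push (Sum.inr M.k₀) (fun v => ein.symm (v.1.getD default)) <|
        .goto fun _ => emb .callLoad)
      (.goto fun _ => emb (.callRun M.main))
  | .call _ o, _, emb, exit, .callUnload =>
    .pop (Sum.inr M.k₁) (fun v x => (x.map eout, v.2)) <| .branch (fun v => v.1.isSome)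
      (.push (Sum.inl o) (fun v => v.1.getD default) <| .goto fun _ => emb .callUnload)
      (.goto fun _ => exit)
  | .call _ _, _, emb, _, .callRun l =>
    liftStmt M (fun l => emb (.callRun l)) (emb .callUnload) (M.m l)

/-! ### Correctness of the compilation -/

/-- The external machine turns `x` into `y` in time at most `t`. -/
def Outputs (x y : List Γ) (t : ℕ) : Prop :=
  ∃ n ≤ t, StepsTo M.step n (initList M (x.map ein.symm)) (haltList M (y.map eout.symm))

/-- A configuration of the compiled program between two executions of the external machine. -/
def idle {Λ : Type} (l : Λ) (r : Option Γ) (s : K → List Γ) :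
    TM2.Cfg (Alph K Γ M) Λ (Reg Γ M) :=
  ⟨some l, (r, M.initialState), join M s fun _ => []⟩

-- Transferring a word between stacks reverses it, which is why `call` expects its input reversed.
-- The word `w` accumulates what is already loaded.
variable {M} in
theorem stepsTo_load {Λ : Type} {m : Λ → TM2.Stmt (Alph K Γ M) Λ (Reg Γ M)} {i o : K}
    {emb : Label M (.call i o : Prog K Γ) → Λ} {exit : Λ}
    (hm : ∀ l, m (emb l) = code M ein eout _ emb exit l)
    (r : Option Γ) (s : K → List Γ) (x : List Γ) (w : List (M.Γ M.k₀))
    (hx : s i = x) :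
    StepsTo (TM2.step m) (x.length + 1)
      ⟨some (emb .callLoad), (r, M.initialState), join M s (update (fun _ => []) M.k₀ w)⟩
      ⟨some (emb (.callRun M.main)), (none, M.initialState),
        join M (update s i []) (update (fun _ => []) M.k₀ (x.reverse.map ein.symm ++ w))⟩ := by
  induction x generalizing r s w with
  | nil =>
    refine StepsTo.single ?_
    simp [TM2.step, hm, code, hx]
  | cons a x ih =>
    have h := ih (some a) (update s i x) (ein.symm a :: w) (by simp)
    refine StepsTo.head ?_ (by simpa using h)
    simp [TM2.step, hm, code, hx]

variable {M} in
theorem stepsTo_unload {Λ : Type} {m : Λ → TM2.Stmt (Alph K Γ M) Λ (Reg Γ M)} {i o : K}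
    {emb : Label M (.call i o : Prog K Γ) → Λ} {exit : Λ}
    (hm : ∀ l, m (emb l) = code M ein eout _ emb exit l)
    (r : Option Γ) (s : K → List Γ) (y : List Γ) :
    StepsTo (TM2.step m) (y.length + 1)
      ⟨some (emb .callUnload), (r, M.initialState),
        join M s (update (fun _ => []) M.k₁ (y.map eout.symm))⟩
      (idle M exit none (update s o (y.reverse ++ s o))) := by
  induction y generalizing r s with
  | nil =>
    refine StepsTo.single ?_
    simp [TM2.step, hm, code, idle]
  | cons a y ih =>
    have h := ih (some a) (update s o (a :: s o))
    refine StepsTo.head ?_ (by simpa using h)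
    simp [TM2.step, hm, code]

-- Correctness of the compiler, by induction on the derivation. The embedding and the exit must
-- vary: the exit of the first part of a sequence is the start of the second, and the exit of a loop
-- body is the head of the loop.
variable {M ein eout} in
theorem Exec.stepsTo {p : Prog K Γ} {s s' : K → List Γ} {t : ℕ}
    (h : Exec (Outputs M ein eout) p s s' t) {Λ : Type}
    {m : Λ → TM2.Stmt (Alph K Γ M) Λ (Reg Γ M)} {emb : Label M p → Λ} {exit : Λ}
    (hm : ∀ l, m (emb l) = code M ein eout _ emb exit l) (r : Option Γ) :
    ∃ r', ∃ n ≤ t, StepsTo (TM2.step m) n (idle M (emb (start M p)) r s) (idle M exit r' s') := by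
  induction h generalizing exit r with
  | skip => exact ⟨r, 1, le_rfl, .single (by simp [idle, TM2.step, hm, code, start])⟩
  | push => exact ⟨r, 1, le_rfl, .single (by simp [idle, TM2.step, hm, code, start])⟩
  | pop => exact ⟨r, 1, le_rfl, .single (by simp [idle, TM2.step, hm, code, start])⟩
  | @seq p q s s' s'' t t' _ _ ih ih' =>
    obtain ⟨r₁, n₁, h₁, H₁⟩ := ih (emb := fun l => emb (.seqLeft l))
      (exit := emb (.seqRight (start M q))) (fun l => by rw [hm]; rfl) r
    obtain ⟨r₂, n₂, h₂, H₂⟩ := ih' (emb := fun l => emb (.seqRight l)) (exit := exit)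
      (fun l => by rw [hm]; rfl) r₁
    exact ⟨r₂, n₁ + n₂, by omega, H₁.trans H₂⟩
  | @branch k b s s' t _ ih =>
    obtain ⟨r₁, n₁, h₁, H₁⟩ := ih (emb := fun l => emb (.branchBody (s k).head? l)) (exit := exit)
      (fun l => by rw [hm]; rfl) (s k).head?
    refine ⟨r₁, n₁ + 1, by omega, H₁.head ?_⟩
    simp [idle, TM2.step, hm, code, start]
  | @loop_nil k b s hs =>
    refine ⟨none, 1, le_rfl, .single ?_⟩
    have : update s k [] = s := by rw [← hs, update_eq_self]
    simp [idle, TM2.step, hm, code, start, hs, this]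
  | @loop_cons k b s s' s'' x xs t t' hs _ _ ih ih' =>
    obtain ⟨r₁, n₁, h₁, H₁⟩ := ih (emb := fun l => emb (.loopBody x l)) (exit := emb .loopHead)
      (fun l => by rw [hm]; rfl) (some x)
    obtain ⟨r₂, n₂, h₂, H₂⟩ := ih' hm r₁
    refine ⟨r₂, n₁ + n₂ + 1, by omega, (H₁.trans H₂).head ?_⟩
    simp [idle, TM2.step, hm, code, start, hs]
  | @call i o s x y t hR hx =>
    obtain ⟨n, hn, H⟩ := hR
    have h₁ := stepsTo_load ein eout hm r s x.reverse [] hx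
    have h₂ := stepsTo_liftCfg (m := m) M (fun l => emb (.callRun l)) (emb .callUnload)
      (fun l => by rw [hm]; rfl) none (update s i []) H
    have h₃ := stepsTo_unload ein eout hm none (update s i []) y
    rw [liftCfg, liftCfg, initList_stk, haltList_stk] at h₂
    -- Each transfer takes one step per symbol and one more to notice that the stack is empty.
    refine ⟨none, (x.length + 1) + n + (y.length + 1), by omega, ?_⟩
    refine StepsTo.trans (StepsTo.trans ?_ h₂) h₃
    simpa [idle, start, initList] using h₁
  | mono _ hle ih =>
    obtain ⟨r', n, hn, H⟩ := ih hm r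
    exact ⟨r', n, hn.trans hle, H⟩

/-- The machine that runs a program and then halts. -/
noncomputable def machine [Fintype K] [Fintype Γ] (p : Prog K Γ) (i o : K) : FinTM2 where
  K := K ⊕ M.K
  kDecidableEq := inferInstance
  kFin := haveI := M.kFin; inferInstance
  k₀ := Sum.inl i
  k₁ := Sum.inl o
  Γ := Alph K Γ M
  Λ := Option (Label M p)
  main := some (start M p)
  ΛFin := Fintype.ofFinite _
  σ := Reg Γ M
  initialState := (none, M.initialState)
  σFin := haveI := M.σFin; inferInstance
  Γk₀Fin := inferInstanceAs (Fintype Γ)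
  m l := l.elim (.load (fun _ => (none, M.initialState)) .halt) (code M ein eout p some none)

-- The additional step is taken at the label `none`: `haltList` prescribes the initial internal
-- state, so the register is reset before halting.
variable {M ein eout} in
theorem Exec.machine_outputs [Fintype K] [Fintype Γ] {p : Prog K Γ} {i o : K} {x y : List Γ}
    {t : ℕ} (h : Exec (Outputs M ein eout) p (update (fun _ => []) i x)
      (update (fun _ => []) o y) t) :
    Nonempty (TM2OutputsInTime (machine M ein eout p i o) x (some y) (t + 1)) := by
  obtain ⟨r, n, hn, H⟩ := h.stepsTo (m := (machine M ein eout p i o).m) (emb := some)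
    (exit := none) (fun l => rfl) none
  have H' := H.trans (StepsTo.single (b := ⟨none, (none, M.initialState),
    join M (update (fun _ => []) o y) fun _ => []⟩) rfl)
  refine ⟨⟨⟨n + 1, ?_⟩, Nat.succ_le_succ hn⟩⟩
  have e₁ : initList (machine M ein eout p i o) x =
      idle M (some (start M p)) none (update (fun _ => []) i x) := by
    have : (initList (machine M ein eout p i o) x).stk =
        join M (update (fun _ => []) i x) fun _ => [] := by
      refine (initList_stk (machine M ein eout p i o) x).trans ?_
      refine Eq.trans ?_ (update_join_inl M (fun _ => []) (fun _ => []) i x)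
      exact congrArg (fun S => update S (Sum.inl i) x) (join_nil M).symm
    rw [idle, ← this]; rfl
  have e₂ : haltList (machine M ein eout p i o) y =
      ⟨none, (none, M.initialState), join M (update (fun _ => []) o y) fun _ => []⟩ := by
    have : (haltList (machine M ein eout p i o) y).stk =
        join M (update (fun _ => []) o y) fun _ => [] := by
      refine (haltList_stk (machine M ein eout p i o) y).trans ?_
      refine Eq.trans ?_ (update_join_inl M (fun _ => []) (fun _ => []) o y)
      exact congrArg (fun S => update S (Sum.inl o) y) (join_nil M).symm
    rw [← this]; rfl
  refine (congrArg _ (congrArg some e₁)).trans (Eq.trans H' (congrArg some e₂.symm))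

end Compile

end StackProgram

/-! ### Time-bounded rules for iterating over stacks. -/

namespace StackProgram

open Function

/-! ### Basic programs -/

section Basic

variable {K Γ : Type} [DecidableEq K] {R : List Γ → List Γ → ℕ → Prop}

/-- Moves the content of the stack `a` to the stack `b`; its order is reversed. -/
def move (a b : K) : Prog K Γ := .loop a fun x => .push b x

/-- Empties a stack. -/
def clear (a : K) : Prog K Γ := .loop a fun _ => .skip

/-- Runs `body` on the symbols of the stack `k`, from top to bottom. The stack `t` keeps the symbols
meanwhile, and `k` is restored in the end. -/
def each (k t : K) (body : Γ → Prog K Γ) : Prog K Γ :=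
  .loop k (fun x => .push t x ;; body x) ;; move t k

theorem exec_move {a b : K} (hab : a ≠ b) {x : List Γ} {s : K → List Γ} (hx : s a = x) :
    Exec R (move a b) s (update (update s a []) b (x.reverse ++ s b)) (2 * x.length + 1) := by
  induction x generalizing s with
  | nil =>
    refine (Exec.loop_nil hx).of_eq ?_ le_rfl
    funext j
    by_cases hb : j = b
    · subst hb; simp
    · by_cases ha : j = a
      · subst ha; simp [hb, hx]
      · simp [ha, hb]
  | cons c x ih =>
    have h := ih (s := update (update s a x) b (c :: s b)) (by simp [hab])
    refine (Exec.loop_cons hx Exec.push (by simpa [move, hab.symm] using h)).of_eq ?_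
      (by simp only [List.length_cons]; omega)
    funext j
    by_cases hb : j = b
    · subst hb; simp
    · by_cases ha : j = a
      · subst ha; simp [hb]
      · simp [ha, hb]

theorem exec_clear {a : K} {s : K → List Γ} {x : List Γ} (hx : s a = x) :
    Exec R (clear a) s (update s a []) (2 * x.length + 1) := by
  induction x generalizing s with
  | nil =>
    refine (Exec.loop_nil hx).of_eq ?_ le_rfl
    rw [← hx, update_eq_self]
  | cons c x ih =>
    have h := ih (s := update s a x) (by simp)
    exact (Exec.loop_cons hx Exec.skip h).of_eq (by simp)
      (by simp only [List.length_cons]; omega)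

/-- The invariant `S l₁ l₂` says nothing about `k` and `t`, whose contents change with the iteration
itself; the body is therefore required to work for arbitrary contents `a` and `b` of these two
stacks. -/
theorem exec_loop_push {k t : K} (hkt : k ≠ t) {ι : Type*} {ξ : ι → Γ} {body : Γ → Prog K Γ}
    {C : ℕ} {l : List ι} {S : List ι → List ι → K → List Γ}
    (hbody : ∀ l₁ i l₂, l = l₁ ++ i :: l₂ → ∀ a b, Exec R (body (ξ i))
      (update (update (S l₁ (i :: l₂)) k a) t b) (update (update (S (l₁ ++ [i]) l₂) k a) t b) C)
    {l₁ l₂ : List ι} (hl : l = l₁ ++ l₂) (b : List Γ) :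
    Exec R (.loop k fun x => .push t x ;; body x)
      (update (update (S l₁ l₂) k (l₂.map ξ)) t b)
      (update (update (S l []) k []) t ((l₂.map ξ).reverse ++ b)) (l₂.length * (C + 2) + 1) := by
  induction l₂ generalizing l₁ b with
  | nil =>
    have : l₁ = l := by simpa using hl.symm
    subst this
    exact (Exec.loop_nil (by simp [hkt])).of_eq (by simp) (by simp)
  | cons i l₂ ih =>
    have h := ih (l₁ := l₁ ++ [i]) (by simpa using hl) (ξ i :: b)
    have h' := hbody l₁ i l₂ hl (l₂.map ξ) (ξ i :: b)
    refine (Exec.loop_cons (x := ξ i) (xs := l₂.map ξ) (by simp [hkt])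
      (Exec.seq Exec.push ?_) h).of_eq (by simp) ?_ (t := 1 + C + (l₂.length * (C + 2) + 1) + 1)
    · convert h' using 1
      funext j
      by_cases ht : j = t
      · subst ht; simp [hkt.symm]
      · by_cases hk : j = k
        · subst hk; simp [ht]
        · simp [ht, hk]
    · simp only [List.length_cons]
      ring_nf
      omega

/-- The rule for `each`: `S l₁ l₂` are the stacks after the symbols of `l₁` have been processed and
when those of `l₂` remain. -/
theorem exec_each {k t : K} (hkt : k ≠ t) {ι : Type*} {ξ : ι → Γ} {body : Γ → Prog K Γ}
    {C : ℕ} {l : List ι} {S : List ι → List ι → K → List Γ} {s s' : K → List Γ}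
    (hs : s = S [] l) (hs' : s' = S l []) (hk : s k = l.map ξ) (ht : s t = [])
    (hk' : s' k = l.map ξ) (ht' : s' t = [])
    (hbody : ∀ l₁ i l₂, l = l₁ ++ i :: l₂ → ∀ a b, Exec R (body (ξ i))
      (update (update (S l₁ (i :: l₂)) k a) t b)
      (update (update (S (l₁ ++ [i]) l₂) k a) t b) C) :
    Exec R (each k t body) s s' (l.length * (C + 4) + 2) := by
  have h₁ := exec_loop_push hkt hbody (l₁ := []) (l₂ := l) rfl []
  have h₂ := exec_move (R := R) hkt.symm (x := (l.map ξ).reverse)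
    (s := update (update (S l []) k []) t ((l.map ξ).reverse ++ [])) (by simp)
  have e : update (update (S [] l) k (l.map ξ)) t [] = s := by
    rw [← hs, ← hk, update_eq_self, ← ht, update_eq_self]
  rw [e] at h₁
  refine (h₁.seq h₂).of_eq ?_ ?_
  · funext j
    by_cases hj : j = k
    · subst hj; simp [hkt, hk']
    · by_cases hj' : j = t
      · subst hj'; simp [hj, ht']
      · simp [hj, hj', hs']
  · simp only [List.length_reverse, List.length_map]
    ring_nf
    omega

theorem exec_each_push {k t b : K} (hkt : k ≠ t) (hkb : k ≠ b) (htb : t ≠ b) {g : Γ → Γ}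
    {x : List Γ} {s : K → List Γ} (hk : s k = x) (ht : s t = []) :
    Exec R (each k t fun c => .push b (g c)) s (update s b ((x.map g).reverse ++ s b))
      (x.length * 5 + 2) := by
  refine exec_each (ξ := id) (l := x) (C := 1)
    (S := fun l₁ _ => update s b ((l₁.map g).reverse ++ s b)) hkt (by simp) rfl (by simpa)
    (by simpa) (by simpa [hkb] using hk) (by simpa [htb] using ht) ?_
  intro l₁ i l₂ _ a c
  refine Exec.push.of_eq ?_ le_rfl
  funext j
  by_cases hb : j = b
  · subst hb; simp [hkb.symm, htb.symm]
  · by_cases ht : j = t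
    · subst ht; simp [hb]
    · by_cases hk : j = k
      · subst hk; simp [ht, hb]
      · simp [ht, hk, hb]

/-- `Emits R P p o w C`: when `P` holds, the program `p` pushes the string `w` to the stack `o` in
time at most `C` and changes nothing else. -/
def Emits (R : List Γ → List Γ → ℕ → Prop) (P : (K → List Γ) → Prop) (p : Prog K Γ) (o : K)
    (w : List Γ) (C : ℕ) : Prop :=
  ∀ s, P s → Exec R p s (update s o (w.reverse ++ s o)) C

theorem Emits.skip {P : (K → List Γ) → Prop} {o : K} : Emits R P .skip o [] 1 :=
  fun s _ => Exec.skip.of_eq (by simp) le_rfl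

theorem Emits.push {P : (K → List Γ) → Prop} {o : K} {a : Γ} : Emits R P (.push o a) o [a] 1 :=
  fun s _ => Exec.push.of_eq (by simp) le_rfl

theorem Emits.seq {P : (K → List Γ) → Prop} {o : K} (hP : ∀ s x, P s → P (update s o x))
    {p q : Prog K Γ} {w w' : List Γ} {C C' : ℕ} (hp : Emits R P p o w C)
    (hq : Emits R P q o w' C') : Emits R P (p ;; q) o (w ++ w') (C + C') :=
  fun s hs => ((hp s hs).seq (hq _ (hP s _ hs))).of_eq (by simp) le_rfl

/-- The precondition `Q` of the body has to survive any change of the three stacks the loop touches.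
In nested loops it is what remains of `P` after dropping the stacks of the outer loop. -/
theorem Emits.each {P Q : (K → List Γ) → Prop} {k t o : K} (hkt : k ≠ t) (hko : k ≠ o)
    (hto : t ≠ o) {ι : Type*} {ξ : ι → Γ} {f : ι → List Γ} {l : List ι} {body : Γ → Prog K Γ}
    {C : ℕ} (hP : ∀ s, P s → s k = l.map ξ ∧ s t = [])
    (hQ : ∀ s a b c, P s → Q (update (update (update s o c) k a) t b))
    (hbody : ∀ i ∈ l, Emits R Q (body (ξ i)) o (f i) C) :
    Emits R P (each k t body) o (l.flatMap f) (l.length * (C + 4) + 2) := by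
  intro s hs
  obtain ⟨hk, ht⟩ := hP s hs
  refine exec_each (ξ := ξ) (l := l) (C := C)
    (S := fun l₁ _ => update s o ((l₁.flatMap f).reverse ++ s o)) hkt (by simp) rfl hk ht
    (by simpa [hko] using hk) (by simpa [hto] using ht) ?_
  intro l₁ i l₂ hl a b
  refine (hbody i (by simp [hl]) _ (hQ s a b _ hs)).of_eq ?_ le_rfl
  funext j
  by_cases hb : j = o
  · subst hb; simp [hko.symm, hto.symm]
  · by_cases ht : j = t
    · subst ht; simp [hb]
    · by_cases hk : j = k
      · subst hk; simp [ht, hb]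
      · simp [ht, hk, hb]

/-- Replaces the content `x` of the stack `k` by `a :: x.dropLast`. -/
def shift (a : Γ) (k t : K) : Prog K Γ := move k t ;; .pop t ;; move t k ;; .push k a

/-- After the move to `t` the bottom symbol of `k` lies on top, where it can be popped. -/
theorem exec_shift {a : Γ} {k t : K} (hkt : k ≠ t) {s : K → List Γ} {x : List Γ} (hk : s k = x)
    (ht : s t = []) :
    Exec R (shift a k t) s (update s k (a :: x.dropLast)) (4 * x.length + 4) := by
  have h₁ := exec_move (R := R) hkt hk
  have h₂ := exec_move (R := R) hkt.symm (x := x.reverse.tail)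
    (s := update (update s k []) t x.reverse.tail) (by simp)
  refine (h₁.seq (Exec.pop.seq ((h₂.of_start_eq (by simp [ht])).seq Exec.push))).of_eq ?_ ?_
  · funext j
    by_cases hj : j = k
    · subst hj; simp [hkt, List.tail_reverse]
    · by_cases hj' : j = t
      · subst hj'; simp [hj, ht]
      · simp [hj, hj']
  · simp only [List.length_tail, List.length_reverse]
    omega

end Basic

end StackProgram

/-! ### Binary and unary arithmetic on stacks. -/

namespace StackProgram

open Function Computability

/-! ### Binary numbers -/

/-- The successor of a binary number, least significant bit first. -/
def incBits : List Bool → List Bool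
  | [] => [true]
  | false :: l => true :: l
  | true :: l => false :: incBits l

theorem encodePosNum_succ (n : PosNum) : encodePosNum n.succ = incBits (encodePosNum n) := by
  induction n with
  | one => rfl
  | bit0 n ih => rfl
  | bit1 n ih => simp [PosNum.succ, encodePosNum, incBits, ih]

theorem encodeNat_succ (n : ℕ) : encodeNat (n + 1) = incBits (encodeNat n) := by
  unfold encodeNat
  rw [Nat.cast_succ, Num.add_one]
  cases (n : Num) with
  | zero => rfl
  | pos p => exact encodePosNum_succ p

theorem encodeNat_zero : encodeNat 0 = [] := rfl

theorem length_incBits_le (l : List Bool) : (incBits l).length ≤ l.length + 1 := by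
  induction l with
  | nil => simp [incBits]
  | cons b l ih => cases b <;> simp [incBits] ; omega

/-- A logarithmic bound is not needed, since all running times are polynomials in the number of
vertices. -/
theorem length_encodeNat_le (n : ℕ) : (encodeNat n).length ≤ n := by
  induction n with
  | zero => simp [encodeNat_zero]
  | succ n ih =>
    rw [encodeNat_succ]
    exact (length_incBits_le _).trans (Nat.succ_le_succ ih)

/-- The value of a binary number, most significant bit first. -/
def bitsValue (l : List Bool) : ℕ := l.foldl (fun v b => 2 * v + b.toNat) 0

theorem bitsValue_append_singleton (l : List Bool) (b : Bool) :
    bitsValue (l ++ [b]) = 2 * bitsValue l + b.toNat := by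
  simp [bitsValue]

theorem bitsValue_le_append (l l' : List Bool) : bitsValue l ≤ bitsValue (l ++ l') := by
  induction l' using List.reverseRecOn with
  | nil => simp
  | append_singleton l' b ih =>
    rw [← List.append_assoc, bitsValue_append_singleton]
    omega

theorem bitsValue_reverse_incBits (l : List Bool) :
    bitsValue (incBits l).reverse = bitsValue l.reverse + 1 := by
  induction l with
  | nil => rfl
  | cons b l ih =>
    cases b
    · simp [incBits, bitsValue_append_singleton]
    · simp only [incBits, List.reverse_cons, bitsValue_append_singleton, ih, Bool.toNat_false,
        Bool.toNat_true]
      omega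

theorem bitsValue_reverse_encodeNat (n : ℕ) : bitsValue (encodeNat n).reverse = n := by
  induction n with
  | zero => rfl
  | succ n ih => rw [encodeNat_succ, bitsValue_reverse_incBits, ih]

/-! ### Programs on binary and unary numbers -/

variable {K : Type} [DecidableEq K] {R : List (Option Bool) → List (Option Bool) → ℕ → Prop}

/-- Moves the bits before the next separator from the stack `i` to the stack `o` and removes the
separator. -/
def readNum (i o c : K) : Prog K (Option Bool) :=
  .push c none ;; .loop c fun _ => .branch i fun
    | some (some b) => .pop i ;; .push o (some b) ;; .push c none
    | _ => .pop i

/-- The only loop of the language runs until a stack is empty. A loop with another exit condition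
keeps a token on `c`: each round consumes it and puts it back only to continue. -/
theorem exec_readNum {i o c : K} (hio : i ≠ o) (hic : i ≠ c) (hoc : o ≠ c)
    {s : K → List (Option Bool)} {l : List Bool} {r : List (Option Bool)}
    (hi : s i = l.map some ++ none :: r) (hc : s c = []) :
    Exec R (readNum i o c) s (update (update s i r) o ((l.map some).reverse ++ s o))
      (5 * l.length + 5) := by
  have key : ∀ (l : List Bool) (s : K → List (Option Bool)), s i = l.map some ++ none :: r →
      s c = [none] → Exec R (.loop c fun _ => .branch i fun
        | some (some b) => .pop i ;; .push o (some b) ;; .push c none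
        | _ => .pop i) s (update (update (update s i r) o ((l.map some).reverse ++ s o)) c [])
        (5 * l.length + 4) := by
    intro l
    induction l with
    | nil =>
      intro s hi hc
      refine (Exec.loop_cons hc (Exec.branch (t := 1) (s' := update (update s c []) i r) ?_)
        (Exec.loop_nil (by simp [hic.symm]))).of_eq ?_ (by simp)
      · simp only [hic, ne_eq, not_false_eq_true, update_of_ne, hi, List.map_nil, List.nil_append,
          List.head?_cons]
        exact Exec.pop.of_eq (by simp [hic, hi]) le_rfl
      · funext j
        by_cases h₁ : j = c
        · subst h₁; simp [hic.symm]
        · by_cases h₂ : j = o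
          · subst h₂; simp [h₁, hio.symm]
          · by_cases h₃ : j = i
            · subst h₃; simp [h₁, h₂]
            · simp [h₁, h₂, h₃]
    | cons b l ih =>
      intro s hi hc
      have h := ih (update (update (update (update s c []) i (l.map some ++ none :: r)) o
        (some b :: s o)) c [none]) (by simp [hic, hio]) (by simp)
      refine (Exec.loop_cons hc (Exec.branch (t := 3) ?_) h).of_eq ?_
        (by simp only [List.length_cons]; omega)
      · simp only [hic, ne_eq, not_false_eq_true, update_of_ne, hi, List.map_cons, List.cons_append,
          List.head?_cons]
        exact (Exec.pop.seq (Exec.push.seq Exec.push)).of_eq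
          (by simp [hic, hi, hoc, hic.symm, hoc.symm, hio.symm]) le_rfl
      · funext j
        by_cases h₁ : j = c
        · subst h₁; simp
        · by_cases h₂ : j = o
          · subst h₂; simp [h₁]
          · by_cases h₃ : j = i
            · subst h₃; simp [h₁, h₂]
            · simp [h₁, h₂, h₃]
  have h := key l (update s c [none]) (by simpa [hic] using hi) (by simp)
  refine ((Exec.push (k := c) (a := none)).seq (h.of_start_eq (by simp [hc]))).of_eq ?_ (by omega)
  funext j
  by_cases h₁ : j = c
  · subst h₁; simp [hic.symm, hoc.symm, hc]
  · by_cases h₂ : j = o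
    · subst h₂; simp [h₁]
    · by_cases h₃ : j = i
      · subst h₃; simp [h₁, h₂]
      · simp [h₁, h₂, h₃]

/-- Increments the binary number on the stack `k`. -/
def increment (k t c : K) : Prog K (Option Bool) :=
  .push c none ;; .loop c (fun _ => .branch k fun
    | some (some true) => .pop k ;; .push t (some false) ;; .push c none
    | some (some false) => .pop k ;; .push k (some true)
    | _ => .push k (some true)) ;; move t k

theorem exec_increment {k t c : K} (hkt : k ≠ t) (hkc : k ≠ c) (htc : t ≠ c)
    {s : K → List (Option Bool)} {l : List Bool} (hk : s k = l.map some) (ht : s t = [])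
    (hc : s c = []) :
    Exec R (increment k t c) s (update s k ((incBits l).map some)) (7 * l.length + 7) := by
  -- Here `z` collects on `t` the zeros written while the carry propagates, and `r` is what `k`
  -- holds once the carry has been absorbed.
  have key : ∀ (l : List Bool) (s : K → List (Option Bool)), s k = l.map some →
      s c = [none] → ∃ z r : List Bool, z.length ≤ l.length ∧ incBits l = z.reverse ++ r ∧
        Exec R (.loop c (fun _ => .branch k fun
        | some (some true) => .pop k ;; .push t (some false) ;; .push c none
        | some (some false) => .pop k ;; .push k (some true)
        | _ => .push k (some true))) s
          (update (update (update s k (r.map some)) t (z.map some ++ s t)) c [])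
          (5 * l.length + 5) := by
    intro l
    induction l with
    | nil =>
      intro s hk hc
      refine ⟨[], [true], by simp, rfl, ?_⟩
      refine (Exec.loop_cons hc (Exec.branch (t := 1)
        (s' := update (update s c []) k [some true]) ?_)
        (Exec.loop_nil (by simp [hkc.symm]))).of_eq ?_ (by simp)
      · simp only [hkc, ne_eq, not_false_eq_true, update_of_ne, hk, List.map_nil, List.head?_nil]
        exact Exec.push.of_eq (by simp [hkc, hk]) le_rfl
      · funext j
        by_cases h₁ : j = c
        · subst h₁; simp [hkc.symm]
        · by_cases h₂ : j = t
          · subst h₂; simp [h₁, hkt.symm]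
          · by_cases h₃ : j = k
            · subst h₃; simp [h₁, h₂]
            · simp [h₁, h₂, h₃]
    | cons b l ih =>
      intro s hk hc
      cases b with
      | false =>
        refine ⟨[], true :: l, by simp, rfl, ?_⟩
        refine (Exec.loop_cons hc (Exec.branch (t := 2)
          (s' := update (update s c []) k ((true :: l).map some)) ?_)
          (Exec.loop_nil (by simp [hkc.symm]))).of_eq ?_ (by simp)
        · simp only [hkc, ne_eq, not_false_eq_true, update_of_ne, hk, List.map_cons,
            List.head?_cons]
          exact (Exec.pop.seq Exec.push).of_eq (by simp [hkc, hk]) le_rfl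
        · funext j
          by_cases h₁ : j = c
          · subst h₁; simp [hkc.symm]
          · by_cases h₂ : j = t
            · subst h₂; simp [h₁, hkt.symm]
            · by_cases h₃ : j = k
              · subst h₃; simp [h₁, h₂]
              · simp [h₁, h₂, h₃]
      | true =>
        obtain ⟨z, r, hz, hl, h⟩ := ih (update (update (update (update s c []) k (l.map some)) t
          (some false :: s t)) c [none]) (by simp [hkc, hkt]) (by simp)
        refine ⟨z ++ [false], r, by simpa using hz, by simp [incBits, hl], ?_⟩
        refine (Exec.loop_cons hc (Exec.branch (t := 3) ?_) h).of_eq ?_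
          (by simp only [List.length_cons]; omega)
        · simp only [hkc, ne_eq, not_false_eq_true, update_of_ne, hk, List.map_cons,
            List.head?_cons]
          exact (Exec.pop.seq (Exec.push.seq Exec.push)).of_eq
            (by simp [hkc, hk, htc, hkc.symm, htc.symm, hkt.symm]) le_rfl
        · funext j
          by_cases h₁ : j = c
          · subst h₁; simp
          · by_cases h₂ : j = t
            · subst h₂; simp [h₁]
            · by_cases h₃ : j = k
              · subst h₃; simp [h₁, h₂]
              · simp [h₁, h₂, h₃]
  obtain ⟨z, r, hz, hl, h⟩ := key l (update s c [none]) (by simpa [hkc] using hk) (by simp)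
  have hm := exec_move (R := R) hkt.symm (x := z.map some) (s := update (update (update
    (update s c [none]) k (r.map some)) t (z.map some ++ update s c [none] t)) c [])
    (by simp [htc, ht])
  refine ((Exec.push (k := c) (a := none)).seq
    ((h.of_start_eq (by simp [hc])).seq hm)).of_eq ?_ ?_
  · funext j
    by_cases h₁ : j = c
    · subst h₁; simp [hkc.symm, htc.symm, hc]
    · by_cases h₂ : j = t
      · subst h₂; simp [hkt.symm, ht]
      · by_cases h₃ : j = k
        · subst h₃; simp [h₁, h₂, hl]
        · simp [h₁, h₂, h₃]
  · simp only [List.length_map]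
    omega

/-- Doubles the unary number on the stack `u`. -/
def double (u t : K) : Prog K (Option Bool) :=
  .loop u (fun x => .push t x ;; .push t x) ;; move t u

theorem exec_double {u t : K} (hut : u ≠ t) {s : K → List (Option Bool)} {a : Option Bool} {m : ℕ}
    (hu : s u = List.replicate m a) (ht : s t = []) :
    Exec R (double u t) s (update s u (List.replicate (2 * m) a)) (7 * m + 2) := by
  have key : ∀ (m : ℕ) (s : K → List (Option Bool)), s u = List.replicate m a →
      Exec R (.loop u (fun x => .push t x ;; .push t x)) s
        (update (update s u []) t (List.replicate (2 * m) a ++ s t)) (3 * m + 1) := by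
    intro m
    induction m with
    | zero =>
      intro s hu
      refine (Exec.loop_nil hu).of_eq ?_ le_rfl
      rw [← show s u = [] from hu, update_eq_self]
      simp
    | succ m ih =>
      intro s hu
      have h := ih (update (update s u (List.replicate m a)) t (a :: a :: s t)) (by simp [hut])
      refine (Exec.loop_cons hu ((Exec.push.seq Exec.push).of_eq
        (by simp [hut.symm]) le_rfl) h).of_eq ?_ (by omega)
      funext j
      by_cases h₁ : j = t
      · subst h₁
        simp [show 2 * (m + 1) = 2 * m + 2 by ring, List.replicate_add]
      · by_cases h₂ : j = u
        · subst h₂; simp [h₁]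
        · simp [h₁, h₂]
  have hm := exec_move (R := R) hut.symm (x := List.replicate (2 * m) a)
    (s := update (update s u []) t (List.replicate (2 * m) a ++ s t)) (by simp [ht])
  refine ((key m s hu).seq hm).of_eq ?_ (by simp; omega)
  funext j
  by_cases h₁ : j = t
  · subst h₁; simp [hut.symm, ht]
  · by_cases h₂ : j = u
    · subst h₂; simp [h₁]
    · simp [h₁, h₂]

/-- Pushes the unary representation of the binary number on the stack `k` (most significant bit
first) to the stack `u`. -/
def toUnary (k t u v : K) : Prog K (Option Bool) :=
  each k t fun b => double u v ;; if b = some true then .push u (some true) else .skip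

/-- Horner's scheme, with intermediate values bounded by the final one. The time grows with the
value, not with the number of bits; this is harmless for `n` and `k ≤ n`, because the input is at
least as long as `n`. -/
theorem exec_toUnary {k t u v : K} (hkt : k ≠ t) (hku : k ≠ u) (hkv : k ≠ v) (htu : t ≠ u)
    (htv : t ≠ v) (huv : u ≠ v) {s : K → List (Option Bool)} {l : List Bool}
    (hk : s k = l.map some) (ht : s t = []) (hu : s u = []) (hv : s v = []) :
    Exec R (toUnary k t u v) s (update s u (List.replicate (bitsValue l) (some true)))
      (l.length * (7 * bitsValue l + 7) + 2) := by
  refine exec_each (ξ := some) (l := l) (C := 7 * bitsValue l + 3)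
    (S := fun l₁ _ => update s u (List.replicate (bitsValue l₁) (some true))) hkt ?_ rfl hk ht
    (by simpa [hku] using hk) (by simpa [htu] using ht) ?_
  · simp [bitsValue, ← hu]
  · intro l₁ b l₂ hl x y
    have hle : bitsValue l₁ ≤ bitsValue l := hl ▸ bitsValue_le_append _ _
    have h := exec_double (R := R) huv (a := some true) (m := bitsValue l₁)
      (s := update (update (update s u (List.replicate (bitsValue l₁) (some true))) k x) t y)
      (by simp [hku.symm, htu.symm]) (by simp [htv.symm, hkv.symm, huv.symm, hv])
    cases b with
    | true =>
      refine (h.seq Exec.push).of_eq ?_ (by omega)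
      funext j
      by_cases h₁ : j = u
      · subst h₁
        simp [hku.symm, htu.symm, bitsValue_append_singleton, List.replicate_succ]
      · by_cases h₂ : j = t
        · subst h₂; simp [h₁]
        · by_cases h₃ : j = k
          · subst h₃; simp [h₁, h₂]
          · simp [h₁, h₂, h₃]
    | false =>
      refine (h.seq Exec.skip).of_eq ?_ (by omega)
      funext j
      by_cases h₁ : j = u
      · subst h₁
        simp [hku.symm, htu.symm, bitsValue_append_singleton]
      · by_cases h₂ : j = t
        · subst h₂; simp [h₁]
        · by_cases h₃ : j = k
          · subst h₃; simp [h₁, h₂]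
          · simp [h₁, h₂, h₃]

end StackProgram

/-! ### The election of a graph, its diffusion and its tie-breaking parameter. -/

namespace ElectionControl

open Finset

/-! ### The reduction -/

open Classical in
/-- The election obtained from an instance of Densest-`k`-Subgraph. Its voters are the pairs of
vertices. The pair `(a, a)` influences the pairs that contain `a`. A voter `(a, b)` that is an edge
of the graph prefers `c_1` by two points, and all others prefer `c_0`. -/
noncomputable def reduction (I : DkSInstance) : ECSInstance 1 where
  n := I.n * I.n
  E := {e | (finProdFinEquiv.symm e.1).1 = (finProdFinEquiv.symm e.1).2 ∧
    ((finProdFinEquiv.symm e.1).1 = (finProdFinEquiv.symm e.2).1 ∨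
      (finProdFinEquiv.symm e.1).1 = (finProdFinEquiv.symm e.2).2)}
  p _ := 1
  p_nonneg _ := zero_le_one
  p_le_one _ := le_rfl
  π v := if I.G.Adj (finProdFinEquiv.symm v).1 (finProdFinEquiv.symm v).2 then ![0, 2] else ![1, 0]
  π_injective v := by
    intro i j h
    split_ifs at h <;> fin_cases i <;> fin_cases j <;> simp_all
  B := I.k

variable {I : DkSInstance}

/-- The voter of the reduction that belongs to a pair of vertices. -/
def voter (a b : Fin I.n) : Fin (reduction I).n := finProdFinEquiv (a, b)

theorem exists_eq_voter (v : Fin (reduction I).n) : ∃ a b : Fin I.n, v = voter a b :=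
  ⟨(finProdFinEquiv.symm v).1, (finProdFinEquiv.symm v).2,
    (finProdFinEquiv.apply_symm_apply v).symm⟩

@[simp] theorem voter_inj {a b c d : Fin I.n} : voter a b = voter c d ↔ a = c ∧ b = d :=
  finProdFinEquiv.apply_eq_iff_eq.trans Prod.mk_inj

theorem mem_reduction_E {a b c d : Fin I.n} :
    (voter a b, voter c d) ∈ (reduction I).E ↔ a = b ∧ (a = c ∨ a = d) := by
  refine mem_filter.trans ?_
  rw [show finProdFinEquiv.symm (voter a b, voter c d).1 = (a, b) from
      finProdFinEquiv.symm_apply_apply _,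
    show finProdFinEquiv.symm (voter a b, voter c d).2 = (c, d) from
      finProdFinEquiv.symm_apply_apply _]
  exact and_iff_right (mem_univ _)

open Classical in
theorem reduction_π (a b : Fin I.n) :
    (reduction I).π (voter a b) = if I.G.Adj a b then ![0, 2] else ![1, 0] := by
  simp only [reduction]
  rw [show finProdFinEquiv.symm (voter a b) = (a, b) from finProdFinEquiv.symm_apply_apply _]

theorem reduction_π_of_adj {a b : Fin I.n} (h : I.G.Adj a b) :
    (reduction I).π (voter a b) = ![0, 2] := by
  rw [reduction_π, if_pos h]

theorem reduction_π_of_not_adj {a b : Fin I.n} (h : ¬ I.G.Adj a b) :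
    (reduction I).π (voter a b) = ![1, 0] := by
  rw [reduction_π, if_neg h]

/-! ### Diffusion and live graphs -/

/-- If every edge that can be continued is a loop, paths of length two reach nothing new and the
cascade is over after one round. -/
theorem isInfluenced_iff {n : ℕ} {H : Finset (Fin n × Fin n)}
    (hH : ∀ u v w, (u, v) ∈ H → (v, w) ∈ H → u = v) {s v : Fin n} :
    IsInfluenced H s v ↔ s = v ∨ (s, v) ∈ H := by
  constructor
  · rintro ⟨t, ht⟩
    induction t generalizing v with
    | zero => simp_all [cascade]
    | succ t ih =>
      simp only [cascade, mem_filter, mem_univ, true_and] at ht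
      obtain ⟨-, u, hu, huv⟩ := ht
      rcases ih hu with rfl | hsu
      · exact Or.inr huv
      · exact Or.inr (hH s u v hsu huv ▸ huv)
  · intro h
    by_cases hsv : s = v
    · exact ⟨0, by simp [cascade, hsv]⟩
    · exact ⟨1, by simpa [cascade, Ne.symm hsv] using h.resolve_left hsv⟩

theorem isInfluenced_reduction {s : Fin (reduction I).n} {a b : Fin I.n} (hab : a ≠ b) :
    IsInfluenced (reduction I).E s (voter a b) ↔
      s = voter a a ∨ s = voter b b ∨ s = voter a b := by
  rw [isInfluenced_iff]
  · obtain ⟨c, d, rfl⟩ := exists_eq_voter s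
    rw [mem_reduction_E]
    simp only [voter_inj]
    grind
  -- Only diagonal voters have outgoing edges, and `(a, a)` reaches no diagonal voter except itself.
  · intro u v w huv hvw
    obtain ⟨a, b, rfl⟩ := exists_eq_voter u
    obtain ⟨c, d, rfl⟩ := exists_eq_voter v
    obtain ⟨e, f, rfl⟩ := exists_eq_voter w
    rw [mem_reduction_E] at huv hvw
    simp only [voter_inj]
    grind

/-- A live graph that misses an edge of `J.E` has a factor `1 - 1 = 0` in its probability, so only
the full network contributes. -/
theorem expectedGain_of_certain {ℓ : ℕ} {J : Election ℓ} (hp : ∀ e, J.p e = 1)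
    (P : SeedPlan ℓ J.n) :
    J.expectedGain P = ((J.MoV P J.E - J.MoV SeedPlan.empty J.E : ℤ) : ℚ) := by
  unfold Election.expectedGain
  rw [Finset.sum_eq_single_of_mem J.E (mem_powerset_self _)]
  · have : J.liveProb J.E = 1 := prod_eq_one fun e he => by simp [he, hp]
    rw [this, one_mul]
  · intro H hH hne
    obtain ⟨e, he, heH⟩ := Finset.exists_of_ssubset
      ((mem_powerset.1 hH).ssubset_of_ne hne)
    have : J.liveProb H = 0 := prod_eq_zero he (by simp [heH, hp])
    rw [this, zero_mul]

theorem MoV_two (J : Election 1) (P : SeedPlan 1 J.n) (H : Finset (Fin J.n × Fin J.n)) :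
    J.MoV P H = (J.supporters P H 0).card - (J.supporters P H 1).card := by
  unfold Election.MoV
  rw [show (univ.filter (· ≠ 0) : Finset (Fin 2)) = {1} by decide]
  simp

theorem mem_supporters_zero {J : Election 1} {P : SeedPlan 1 J.n} {H : Finset (Fin J.n × Fin J.n)}
    {v : Fin J.n} : v ∈ J.supporters P H 0 ↔ J.revisedScore P H v 1 < J.revisedScore P H v 0 := by
  simp [Election.supporters, Fin.forall_fin_two]

theorem mem_supporters_one {J : Election 1} {P : SeedPlan 1 J.n} {H : Finset (Fin J.n × Fin J.n)}
    {v : Fin J.n} : v ∈ J.supporters P H 1 ↔ J.revisedScore P H v 0 < J.revisedScore P H v 1 := by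
  simp [Election.supporters, Fin.forall_fin_two]

theorem reduction_ε_of_adj {a b : Fin I.n} (h : I.G.Adj a b) : (reduction I).ε = 1 / 3 := by
  have : (univ.sup fun v => univ.sup ((reduction I).π v)) = 2 := by
    apply le_antisymm
    · refine Finset.sup_le fun v _ => Finset.sup_le fun i _ => ?_
      obtain ⟨c, d, rfl⟩ := exists_eq_voter v
      rw [reduction_π]
      split_ifs <;> fin_cases i <;> simp
    · refine le_trans ?_ (le_sup (f := fun v => univ.sup ((reduction I).π v))
        (mem_univ (voter a b)))
      refine le_trans ?_ (le_sup (f := (reduction I).π (voter a b)) (mem_univ 1))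
      simp [reduction_π_of_adj h]
  unfold Election.ε
  rw [this]
  norm_num

/-- A voter has to be given: without voters the maximal score is `0` and `ε = 1`. -/
theorem reduction_ε_lt_one (v : Fin (reduction I).n) : (reduction I).ε < 1 := by
  have : 1 ≤ univ.sup fun v => univ.sup ((reduction I).π v) := by
    obtain ⟨a, b, rfl⟩ := exists_eq_voter v
    by_cases h : I.G.Adj a b
    · refine le_trans ?_ (le_sup (f := fun v => univ.sup ((reduction I).π v))
        (mem_univ (voter a b)))
      refine le_trans ?_ (le_sup (f := (reduction I).π (voter a b)) (mem_univ 1))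
      simp [reduction_π_of_adj h]
    · refine le_trans ?_ (le_sup (f := fun v => univ.sup ((reduction I).π v))
        (mem_univ (voter a b)))
      refine le_trans ?_ (le_sup (f := (reduction I).π (voter a b)) (mem_univ 0))
      simp [reduction_π_of_not_adj h]
  unfold Election.ε
  rw [div_lt_one (by positivity)]
  have : (1 : ℚ) ≤ ((univ.sup fun v => univ.sup ((reduction I).π v) : ℕ) : ℚ) := by
    exact_mod_cast this
  linarith

end ElectionControl

/-! ### The gain of a seed plan compared with the number of induced edges. -/

namespace ElectionControl

open Finset

/-! ### Votes after the diffusion -/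

theorem SeedPlan.IsSingleNews.exists_info {ℓ n : ℕ} {P : SeedPlan ℓ n} (hP : P.IsSingleNews) :
    ∃ (j : Fin (ℓ + 1)) (q : ℤ), (q = 1 ∨ q = -1) ∧
      ∀ s i, P.info s i = if (P s).isSome then (Pi.single j q : Fin (ℓ + 1) → ℤ) i else 0 := by
  obtain ⟨j, q, hq, h⟩ := hP
  refine ⟨j, q, hq, fun s i => ?_⟩
  unfold SeedPlan.info
  cases hs : P s with
  | none => simp
  | some m => simp [h s m hs]

/-- The seeds of a plan. -/
def SeedPlan.seeds {ℓ n : ℕ} (P : SeedPlan ℓ n) : Finset (Fin n) := {s | (P s).isSome}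

theorem SeedPlan.mem_seeds {ℓ n : ℕ} {P : SeedPlan ℓ n} {s : Fin n} :
    s ∈ P.seeds ↔ (P s).isSome := by
  simp [SeedPlan.seeds]

/-- Every seed sends exactly one article, so the budget is a bound on the number of seeds. -/
theorem SeedPlan.IsSingleNews.card_seeds {ℓ n : ℕ} {P : SeedPlan ℓ n} (hP : P.IsSingleNews) :
    P.seeds.card = P.cost := by
  obtain ⟨j, q, hq, h⟩ := hP.exists_info
  unfold SeedPlan.cost SeedPlan.seeds
  rw [card_filter]
  refine sum_congr rfl fun s _ => ?_
  simp only [h]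
  by_cases hs : (P s).isSome
  · simp only [hs, if_true]
    rw [Finset.sum_eq_single_of_mem j (mem_univ j)]
    · rcases hq with rfl | rfl <;> simp
    · intro i _ hi
      simp [Pi.single_eq_of_ne hi]
  · simp [hs]

open Classical in
/-- The number of messages that reach a voter. -/
noncomputable def received {ℓ n : ℕ} (P : SeedPlan ℓ n) (H : Finset (Fin n × Fin n))
    (v : Fin n) : ℕ :=
  #{s ∈ P.seeds | IsInfluenced H s v}

/-- With two candidates only the score difference matters, and praising one has the same effect on
it as attacking the other. The four possible messages thus reduce to a sign `δ`. -/
theorem revisedScore_sub {J : Election 1} {P : SeedPlan 1 J.n} (hP : P.IsSingleNews) :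
    ∃ δ : ℚ, (δ = 1 ∨ δ = -1) ∧ ∀ H v, J.revisedScore P H v 0 - J.revisedScore P H v 1 =
      (1 - J.ε) * ((J.π v 0 : ℚ) - J.π v 1) + δ * received P H v := by
  classical
  obtain ⟨j, q, hq, h⟩ := hP.exists_info
  refine ⟨(((Pi.single j q : Fin 2 → ℤ) 0 - (Pi.single j q : Fin 2 → ℤ) 1 : ℤ) : ℚ), ?_, ?_⟩
  · fin_cases j <;> rcases hq with rfl | rfl <;> simp
  · intro H v
    have key : ∀ i, (∑ s with IsInfluenced H s v, (P.info s i : ℚ)) =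
        ((Pi.single j q : Fin 2 → ℤ) i : ℚ) * received P H v := by
      intro i
      simp only [h, received, SeedPlan.seeds, filter_filter, card_filter]
      push_cast
      rw [mul_sum, sum_filter]
      refine sum_congr rfl fun s _ => ?_
      by_cases h₁ : IsInfluenced H s v <;> by_cases h₂ : (P s).isSome <;> simp [h₁, h₂]
    unfold Election.revisedScore
    rw [key, key]
    push_cast
    ring

theorem SeedPlan.empty_isSingleNews {ℓ n : ℕ} : (SeedPlan.empty : SeedPlan ℓ n).IsSingleNews :=
  ⟨0, 1, Or.inl rfl, fun s m h => by cases h⟩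

theorem received_empty {ℓ n : ℕ} (H : Finset (Fin n × Fin n)) (v : Fin n) :
    received (SeedPlan.empty : SeedPlan ℓ n) H v = 0 := by
  simp [received, SeedPlan.seeds, SeedPlan.empty]

variable {I : DkSInstance}

open Classical in
/-- The voters of the reduction that are edges. -/
noncomputable def edgeVoters (I : DkSInstance) : Finset (Fin (reduction I).n) :=
  {v | (reduction I).π v 0 = 0}

theorem voter_mem_edgeVoters {a b : Fin I.n} : voter a b ∈ edgeVoters I ↔ I.G.Adj a b := by
  by_cases h : I.G.Adj a b
  · simp [edgeVoters, h, reduction_π_of_adj h]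
  · simp [edgeVoters, h, reduction_π_of_not_adj h]

/-- This constant drives the reduction: it lies strictly between one and two messages in absolute
value, and it is not an integer, which excludes ties. -/
theorem revisedScore_sub_of_mem_edgeVoters {v : Fin (reduction I).n} (hv : v ∈ edgeVoters I) :
    (1 - (reduction I).ε) * (((reduction I).π v 0 : ℚ) - (reduction I).π v 1) = -(4 / 3) := by
  obtain ⟨a, b, rfl⟩ := exists_eq_voter v
  have h := voter_mem_edgeVoters.1 hv
  rw [reduction_ε_of_adj h, reduction_π_of_adj h]
  norm_num

theorem revisedScore_sub_of_notMem_edgeVoters {v : Fin (reduction I).n} (hv : v ∉ edgeVoters I) :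
    0 < (1 - (reduction I).ε) * (((reduction I).π v 0 : ℚ) - (reduction I).π v 1) := by
  have hε := reduction_ε_lt_one v
  obtain ⟨a, b, rfl⟩ := exists_eq_voter v
  rw [reduction_π_of_not_adj (fun h => hv (voter_mem_edgeVoters.2 h))]
  simpa using hε

theorem MoV_reduction_empty :
    (reduction I).MoV SeedPlan.empty (reduction I).E =
      ((edgeVoters I)ᶜ.card : ℤ) - (edgeVoters I).card := by
  obtain ⟨δ, -, h⟩ := revisedScore_sub (J := (reduction I).toElection) SeedPlan.empty_isSingleNews
  simp only [received_empty, Nat.cast_zero, mul_zero, add_zero] at h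
  rw [MoV_two]
  congr 3
  · ext v
    have := h (reduction I).E v
    rw [mem_supporters_zero, mem_compl]
    constructor
    · intro h₁ h₂
      rw [revisedScore_sub_of_mem_edgeVoters h₂] at this
      linarith
    · intro h₁
      linarith [revisedScore_sub_of_notMem_edgeVoters h₁]
  · ext v
    have := h (reduction I).E v
    rw [mem_supporters_one]
    constructor
    · intro h₁
      by_contra h₂
      linarith [revisedScore_sub_of_notMem_edgeVoters h₂]
    · intro h₁
      rw [revisedScore_sub_of_mem_edgeVoters h₁] at this
      linarith

/-- The messages that reach an edge come from its ends and from the edge itself. -/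
theorem received_reduction {P : SeedPlan 1 (reduction I).n} {a b : Fin I.n} (hab : a ≠ b) :
    received P (reduction I).E (voter a b) =
      #{s ∈ ({voter a a, voter b b, voter a b} : Finset (Fin (reduction I).n)) | s ∈ P.seeds} := by
  classical
  unfold received
  congr 1
  ext s
  simp only [mem_filter, mem_insert, mem_singleton, isInfluenced_reduction hab]
  tauto

/-- The vertices chosen according to a seed plan. -/
noncomputable def chosen (P : SeedPlan 1 (reduction I).n) : Finset (Fin I.n) :=
  {v | (∃ a, voter a v ∈ P.seeds) ∨ ∃ b, voter v b ∈ P.seeds ∧ voter b b ∈ P.seeds}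

/-- A seed always yields its second entry. The only pair of seeds for which this misses `a` is `(a,
b)`, `(b, b)`, and the second clause of `chosen` is there for that case. -/
theorem mem_chosen_of_two_le_received {P : SeedPlan 1 (reduction I).n} {a b : Fin I.n}
    (hab : a ≠ b) (h : 2 ≤ received P (reduction I).E (voter a b)) :
    a ∈ chosen P ∧ b ∈ chosen P := by
  classical
  rw [received_reduction hab, card_filter, sum_insert (by simp [hab]),
    sum_insert (by simp [hab.symm]), sum_singleton] at h
  simp only [chosen, mem_filter, mem_univ, true_and]
  by_cases h₁ : voter a a ∈ P.seeds <;> by_cases h₂ : voter b b ∈ P.seeds <;>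
    by_cases h₃ : voter a b ∈ P.seeds <;> simp [h₁, h₂, h₃] at h
  · exact ⟨Or.inl ⟨_, h₁⟩, Or.inl ⟨_, h₂⟩⟩
  · exact ⟨Or.inl ⟨_, h₁⟩, Or.inl ⟨_, h₂⟩⟩
  · exact ⟨Or.inl ⟨_, h₁⟩, Or.inl ⟨_, h₃⟩⟩
  · exact ⟨Or.inr ⟨_, h₃, h₂⟩, Or.inl ⟨_, h₂⟩⟩

/-- Each chosen vertex is charged to a seed of its own, to `(v, v)` whenever that is a seed. A seed
`(c, d)` with `c ≠ d` is charged for `d` only if `(d, d)` is not a seed, and for `c` only if `(d,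
d)` is one; so it is never charged twice. -/
theorem card_chosen_le (P : SeedPlan 1 (reduction I).n) : (chosen P).card ≤ P.seeds.card := by
  classical
  have h : ∀ v, ∃ s, v ∈ chosen P → s ∈ P.seeds ∧
      ((∃ a, s = voter a v ∧ (voter v v ∉ P.seeds ∨ a = v)) ∨
        ∃ b, b ≠ v ∧ s = voter v b ∧ voter b b ∈ P.seeds) := by
    intro v
    by_cases hv : v ∈ chosen P
    swap
    · exact ⟨voter v v, fun h => absurd h hv⟩
    simp only [chosen, mem_filter, mem_univ, true_and] at hv
    by_cases hvv : voter v v ∈ P.seeds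
    · exact ⟨_, fun _ => ⟨hvv, Or.inl ⟨v, rfl, Or.inr rfl⟩⟩⟩
    · rcases hv with ⟨a, ha⟩ | ⟨b, hb, hbb⟩
      · exact ⟨_, fun _ => ⟨ha, Or.inl ⟨a, rfl, Or.inl hvv⟩⟩⟩
      · exact ⟨_, fun _ => ⟨hb, Or.inr ⟨b, by rintro rfl; exact hvv hb, rfl, hbb⟩⟩⟩
  choose f hf using h
  refine card_le_card_of_injOn f (fun v hv => (hf v hv).1) ?_
  intro v hv w hw hvw
  have h₁ := (hf v hv).2
  have h₂ := (hf w hw).2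
  rw [← hvw] at h₂
  rcases h₁ with ⟨a, ha, ha'⟩ | ⟨b, hbv, hb, hb'⟩ <;>
    rcases h₂ with ⟨c, hc, hc'⟩ | ⟨d, hdw, hd, hd'⟩
  · rw [ha, voter_inj] at hc
    exact hc.2
  · rw [ha, voter_inj] at hd
    obtain ⟨rfl, rfl⟩ := hd
    rcases ha' with h | h
    · exact absurd hd' h
    · exact h.symm
  · rw [hb, voter_inj] at hc
    obtain ⟨rfl, rfl⟩ := hc
    rcases hc' with h | h
    · exact absurd hb' h
    · exact h
  · rw [hb, voter_inj] at hd
    exact hd.1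

-- Both orientations of an edge are voters, hence the factor two.
open Classical in
theorem two_mul_density (X : Finset (Fin I.n)) :
    2 * I.density X = #{v ∈ edgeVoters I | ∃ a ∈ X, ∃ b ∈ X, v = voter a b} := by
  unfold DkSInstance.density
  rw [← SimpleGraph.coe_edgeFinset, Set.ncard_coe_finset, SimpleGraph.two_mul_card_edgeFinset]
  refine card_bij (fun e _ => voter e.1.1 e.2.1) ?_ ?_ ?_
  · rintro ⟨a, b⟩ h
    simp only [mem_filter, mem_univ, true_and, SimpleGraph.comap_adj] at h
    exact mem_filter.2 ⟨voter_mem_edgeVoters.2 h, a.1, a.2, b.1, b.2, rfl⟩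
  · rintro ⟨a, b⟩ _ ⟨c, d⟩ _ h
    rw [voter_inj] at h
    exact Prod.ext (Subtype.ext h.1) (Subtype.ext h.2)
  · intro v hv
    obtain ⟨hv, a, ha, b, hb, rfl⟩ := mem_filter.1 hv
    exact ⟨(⟨a, ha⟩, ⟨b, hb⟩), by simpa using voter_mem_edgeVoters.1 hv, rfl⟩

theorem density_mono {X Y : Finset (Fin I.n)} (h : X ⊆ Y) : I.density X ≤ I.density Y := by
  classical
  have h' : 2 * I.density X ≤ 2 * I.density Y := by
    rw [two_mul_density, two_mul_density]
    refine card_le_card fun v hv => ?_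
    obtain ⟨hv, a, ha, b, hb, rfl⟩ := mem_filter.1 hv
    exact mem_filter.2 ⟨hv, a, h ha, b, h hb, rfl⟩
  omega

/-- Beyond its initial votes `c_0` can only win the edge voters in `F`, and `c_1` can lose only
these. Each of the two changes is bounded by the size of `F`, which is twice the density. -/
theorem expectedGain_le {P : SeedPlan 1 (reduction I).n} (hP : P.IsSingleNews) :
    (reduction I).expectedGain P ≤ 4 * I.density (chosen P) := by
  classical
  rw [expectedGain_of_certain (fun _ => rfl), MoV_reduction_empty, MoV_two]
  obtain ⟨δ, hδ, h⟩ := revisedScore_sub (J := (reduction I).toElection) hP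
  set F := {v ∈ edgeVoters I | ∃ a ∈ chosen P, ∃ b ∈ chosen P, v = voter a b} with hF
  have hFd : (F.card : ℚ) = 2 * I.density (chosen P) := by
    exact_mod_cast (two_mul_density (chosen P)).symm
  have h₀ : (reduction I).supporters P (reduction I).E 0 ⊆ (edgeVoters I)ᶜ ∪ F := by
    intro v hv
    rw [mem_union, mem_compl]
    by_cases hv' : v ∈ edgeVoters I
    · right
      rw [mem_supporters_zero] at hv
      have := h (reduction I).E v
      rw [revisedScore_sub_of_mem_edgeVoters hv'] at this
      obtain ⟨a, b, rfl⟩ := exists_eq_voter v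
      have hr : 2 ≤ received P (reduction I).E (voter a b) := by
        by_contra hr
        have : (received P (reduction I).E (voter a b) : ℚ) ≤ 1 := by
          exact_mod_cast Nat.lt_succ_iff.1 (not_le.1 hr)
        have : (0 : ℚ) ≤ received P (reduction I).E (voter a b) := Nat.cast_nonneg _
        -- For `δ = 1` a single message leaves a deficit of `1/3`; for `δ = -1` messages only
        -- enlarge the deficit.
        rcases hδ with rfl | rfl <;> linarith
      have := mem_chosen_of_two_le_received (voter_mem_edgeVoters.1 hv').ne hr
      exact mem_filter.2 ⟨hv', a, this.1, b, this.2, rfl⟩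
    · exact Or.inl hv'
  have h₁ : edgeVoters I \ F ⊆ (reduction I).supporters P (reduction I).E 1 := by
    intro v hv
    obtain ⟨hv, hvF⟩ := mem_sdiff.1 hv
    have hs : v ∉ (reduction I).supporters P (reduction I).E 0 := by
      intro h'
      rcases mem_union.1 (h₀ h') with h' | h'
      · exact mem_compl.1 h' hv
      · exact hvF h'
    rw [mem_supporters_zero, not_lt] at hs
    rw [mem_supporters_one]
    refine lt_of_le_of_ne hs fun he => ?_
    have := h (reduction I).E v
    rw [revisedScore_sub_of_mem_edgeVoters hv, he, sub_self] at this
    -- Not voting for `c_0` gives a vote for `c_1` only if there is no tie; a tie would make three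
    -- times a natural number equal to `4` or `-4`.
    have h3 : (3 * received P (reduction I).E v : ℚ) = 4 ∨
        (3 * received P (reduction I).E v : ℚ) = -4 := by
      rcases hδ with rfl | rfl
      · left; linarith
      · right; linarith
    rcases h3 with h3 | h3
    · have : 3 * received P (reduction I).E v = 4 := by exact_mod_cast h3
      omega
    · have : (0 : ℚ) ≤ received P (reduction I).E v := Nat.cast_nonneg _
      linarith
  have c₀ : (#((reduction I).supporters P (reduction I).E 0) : ℚ) ≤
      #(edgeVoters I)ᶜ + #F := by
    exact_mod_cast (card_le_card h₀).trans (card_union_le _ _)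
  have c₁ : (#(edgeVoters I) : ℚ) - #F ≤
      #((reduction I).supporters P (reduction I).E 1) := by
    have := card_le_card h₁
    rw [card_sdiff_of_subset (show F ⊆ edgeVoters I from filter_subset _ _)] at this
    have h2 : #(edgeVoters I) ≤ #((reduction I).supporters P (reduction I).E 1) + #F := by omega
    have : (#(edgeVoters I) : ℚ) ≤ #((reduction I).supporters P (reduction I).E 1) + #F := by
      exact_mod_cast h2
    linarith
  push_cast
  linarith

open Classical in
/-- The seed plan that belongs to a set of vertices. -/
noncomputable def planOf (X : Finset (Fin I.n)) : SeedPlan 1 (reduction I).n :=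
  fun s => if ∃ a ∈ X, s = voter a a then some (Pi.single 0 1) else none

theorem planOf_isSingleNews (X : Finset (Fin I.n)) : (planOf X).IsSingleNews := by
  refine ⟨0, 1, Or.inl rfl, fun s m h => ?_⟩
  unfold planOf at h
  split_ifs at h
  exact (Option.some_injective _ h).symm

theorem voter_mem_seeds_planOf {X : Finset (Fin I.n)} {a b : Fin I.n} :
    voter a b ∈ (planOf X).seeds ↔ a = b ∧ a ∈ X := by
  classical
  rw [SeedPlan.mem_seeds, planOf]
  split_ifs with h
  · obtain ⟨c, hc, h⟩ := h
    rw [voter_inj] at h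
    simp [h.1, h.2, hc]
  · simp only [Option.isSome_none, Bool.false_eq_true, false_iff]
    rintro ⟨rfl, ha⟩
    exact h ⟨a, ha, rfl⟩

theorem card_seeds_planOf (X : Finset (Fin I.n)) : (planOf X).seeds.card = X.card := by
  classical
  refine (card_bij (fun a _ => voter a a) ?_ ?_ ?_).symm
  · exact fun a ha => voter_mem_seeds_planOf.2 ⟨rfl, ha⟩
  · exact fun a _ b _ h => (voter_inj.1 h).1
  · intro s hs
    obtain ⟨a, b, rfl⟩ := exists_eq_voter s
    obtain ⟨rfl, ha⟩ := voter_mem_seeds_planOf.1 hs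
    exact ⟨a, ha, rfl⟩

/-- An edge inside `X` hears from both ends, and `2 > 4/3`. The messages favour `c_0`, so no voter
who already supports `c_0` is lost. -/
theorem le_expectedGain_planOf (X : Finset (Fin I.n)) :
    4 * (I.density X : ℚ) ≤ (reduction I).expectedGain (planOf X) := by
  classical
  rw [expectedGain_of_certain (fun _ => rfl), MoV_reduction_empty, MoV_two]
  set P := planOf X with hPX
  set F := {v ∈ edgeVoters I | ∃ a ∈ X, ∃ b ∈ X, v = voter a b} with hF
  have hFd : (F.card : ℚ) = 2 * I.density X := by
    exact_mod_cast (two_mul_density X).symm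
  -- The difference is recomputed because `revisedScore_sub` leaves the sign unspecified, and here
  -- it must be `+1`.
  have hscore : ∀ v, (reduction I).revisedScore P (reduction I).E v 0 -
      (reduction I).revisedScore P (reduction I).E v 1 =
      (1 - (reduction I).ε) * (((reduction I).π v 0 : ℚ) - (reduction I).π v 1) +
        received P (reduction I).E v := by
    have hinfo : ∀ s, P.info s 0 = (if s ∈ P.seeds then 1 else 0) ∧ P.info s 1 = 0 := by
      intro s
      simp only [SeedPlan.mem_seeds, SeedPlan.info, hPX, planOf]
      split_ifs <;> simp_all
    intro v
    unfold Election.revisedScore received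
    simp only [fun s => (hinfo s).1, fun s => (hinfo s).2]
    have : (#{s ∈ P.seeds | IsInfluenced (reduction I).E s v} : ℚ) =
        ∑ s with IsInfluenced (reduction I).E s v, ((if s ∈ P.seeds then 1 else 0 : ℤ) : ℚ) := by
      push_cast
      rw [← sum_filter, filter_filter, sum_const, nsmul_eq_mul, mul_one]
      congr 2
      ext s
      simp [and_comm]
    rw [this]
    simp only [Int.cast_zero, sum_const_zero]
    ring
  have h₀ : (edgeVoters I)ᶜ ∪ F ⊆ (reduction I).supporters P (reduction I).E 0 := by
    intro v hv
    rw [mem_supporters_zero]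
    have := hscore v
    rcases mem_union.1 hv with hv | hv
    · have h1 := revisedScore_sub_of_notMem_edgeVoters (mem_compl.1 hv)
      have h2 : (0 : ℚ) ≤ received P (reduction I).E v := Nat.cast_nonneg _
      linarith
    · obtain ⟨hv, a, ha, b, hb, rfl⟩ := mem_filter.1 hv
      rw [revisedScore_sub_of_mem_edgeVoters hv] at this
      have hab := (voter_mem_edgeVoters.1 hv).ne
      have h2 : 2 ≤ received P (reduction I).E (voter a b) := by
        rw [received_reduction hab, card_filter, sum_insert (by simp [hab]),
          sum_insert (by simp [hab.symm]), sum_singleton]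
        simp [hPX, voter_mem_seeds_planOf, ha, hb, hab]
      have h2 : (2 : ℚ) ≤ received P (reduction I).E (voter a b) := by exact_mod_cast h2
      linarith
  have h₁ : (reduction I).supporters P (reduction I).E 1 ⊆ edgeVoters I \ F := by
    intro v hv
    rw [mem_supporters_one] at hv
    have h0 : v ∉ (edgeVoters I)ᶜ ∪ F := fun h => by
      have := h₀ h
      rw [mem_supporters_zero] at this
      exact lt_asymm this hv
    rw [mem_union, mem_compl] at h0
    push Not at h0
    exact mem_sdiff.2 h0
  have c₀ := card_le_card h₀
  rw [card_union_of_disjoint] at c₀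
  · have c₁ := card_le_card h₁
    have hle := card_le_card (show F ⊆ edgeVoters I from filter_subset _ _)
    rw [card_sdiff_of_subset (show F ⊆ edgeVoters I from filter_subset _ _)] at c₁
    have c₁' : #((reduction I).supporters P (reduction I).E 1) + #F ≤ #(edgeVoters I) := by
      omega
    have c₀ : (#(edgeVoters I)ᶜ : ℚ) + #F ≤ #((reduction I).supporters P (reduction I).E 0) := by
      exact_mod_cast c₀
    have c₁ : (#((reduction I).supporters P (reduction I).E 1) : ℚ) + #F ≤ #(edgeVoters I) := by
      exact_mod_cast c₁'
    push_cast
    linarith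
  · exact disjoint_left.2 fun v hv hv' => mem_compl.1 hv (mem_filter.1 hv').1

end ElectionControl

/-! ### From seed plans to vertex sets of size `k`, and the codes of all objects involved. -/

namespace ElectionControl

open Finset

/-! ### Padding a set of vertices -/

/-- Sets the first `r` bits that are `false` to `true`. -/
def padBits : ℕ → List Bool → List Bool
  | _, [] => []
  | r, true :: l => true :: padBits r l
  | 0, false :: l => false :: padBits 0 l
  | r + 1, false :: l => true :: padBits r l

@[simp] theorem length_padBits (r : ℕ) (l : List Bool) : (padBits r l).length = l.length := by
  fun_induction padBits r l <;> simp_all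

theorem count_padBits (r : ℕ) (l : List Bool) (h : l.count true + r ≤ l.length) :
    (padBits r l).count true = l.count true + r := by
  fun_induction padBits r l with
  | case1 => simp_all
  | case2 r l ih => simp at h ⊢; rw [ih (by omega)]; omega
  | case3 l ih =>
    have := List.count_le_length (a := true) (l := l)
    simp at h ⊢; exact ih (by omega)
  | case4 r l ih => simp at h ⊢; rw [ih (by omega)]; omega

theorem getD_padBits (r : ℕ) (l : List Bool) (i : ℕ) (h : l.getD i false = true) :
    (padBits r l).getD i false = true := by
  fun_induction padBits r l generalizing i with
  | case1 => simp at h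
  | case2 r l ih => cases i <;> simp_all
  | case3 l ih => cases i <;> simp_all
  | case4 r l ih => cases i <;> simp_all

theorem map_finRange_getD {n : ℕ} {l : List Bool} (h : l.length = n) :
    (List.finRange n).map (fun v : Fin n => l.getD v.1 false) = l := by
  apply List.ext_getElem
  · simp [h]
  · intro i h₁ h₂
    simp [h₂]

theorem card_filter_eq_count {n : ℕ} (f : Fin n → Bool) :
    #{v | f v = true} = ((List.finRange n).map f).count true := by
  rw [List.count, List.countP_map, Finset.card, Finset.filter, Fin.univ_def]
  simp only [Multiset.filter_coe, Multiset.coe_card, List.countP_eq_length_filter]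
  simp [Function.comp_def]

variable {I : DkSInstance}

/-- The characteristic vector of the chosen vertices. -/
noncomputable def chosenBits (P : SeedPlan 1 (reduction I).n) : List Bool :=
  (List.finRange I.n).map fun v => decide (v ∈ chosen P)

/-- The characteristic vector of the chosen vertices, padded to `k` vertices. -/
noncomputable def finalBits (P : SeedPlan 1 (reduction I).n) : List Bool :=
  padBits (I.k - (chosenBits P).count true) (chosenBits P)

/-- The chosen vertices, padded to a set of `k` vertices. -/
noncomputable def finalSet (P : SeedPlan 1 (reduction I).n) : Finset (Fin I.n) :=
  {v | (finalBits P).getD v false = true}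

theorem length_finalBits (P : SeedPlan 1 (reduction I).n) : (finalBits P).length = I.n := by
  simp [finalBits, chosenBits]

theorem count_chosenBits (P : SeedPlan 1 (reduction I).n) :
    (chosenBits P).count true = (chosen P).card := by
  rw [chosenBits, ← card_filter_eq_count]
  simp

theorem card_finalSet {P : SeedPlan 1 (reduction I).n} (hP : (reduction I).Feasible P) :
    (finalSet P).card = I.k := by
  have h : (chosen P).card ≤ I.k :=
    (card_chosen_le P).trans (hP.1.card_seeds.le.trans hP.2)
  have hk := I.k_le
  rw [finalSet, card_filter_eq_count, map_finRange_getD (length_finalBits P), finalBits,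
    count_padBits, count_chosenBits]
  · omega
  · rw [count_chosenBits]
    simp only [chosenBits, List.length_map, List.length_finRange]
    omega

theorem chosen_subset_finalSet (P : SeedPlan 1 (reduction I).n) : chosen P ⊆ finalSet P := by
  intro v hv
  simp only [finalSet, mem_filter, mem_univ, true_and]
  apply getD_padBits
  simp [chosenBits, hv]

/-- The plan of `X` costs exactly `k`, so `P` competes with it: `4ρ` times the density of `X` is at
most the gain of `P`, hence at most four times the density of `chosen P`, and padding only adds
edges. -/
theorem density_finalSet {ρ : ℝ} (hρ : 0 < ρ) {P : SeedPlan 1 (reduction I).n}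
    (hP : (reduction I).Feasible P)
    (hA : ∀ Q : SeedPlan 1 (reduction I).n, (reduction I).Feasible Q →
      ρ * ((reduction I).expectedGain Q : ℝ) ≤ ((reduction I).expectedGain P : ℝ))
    {X : Finset (Fin I.n)} (hX : X.card = I.k) :
    ρ * (I.density X : ℝ) ≤ (I.density (finalSet P) : ℝ) := by
  have hQ : (reduction I).Feasible (planOf X) := by
    refine ⟨planOf_isSingleNews X, ?_⟩
    rw [← (planOf_isSingleNews X).card_seeds, card_seeds_planOf, hX]
    exact le_rfl
  have h₁ := hA _ hQ
  have h₂ : (4 * I.density X : ℝ) ≤ ((reduction I).expectedGain (planOf X) : ℝ) := by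
    exact_mod_cast le_expectedGain_planOf X
  have h₃ : ((reduction I).expectedGain P : ℝ) ≤ 4 * I.density (chosen P) := by
    exact_mod_cast expectedGain_le hP.1
  have h₄ : (I.density (chosen P) : ℝ) ≤ I.density (finalSet P) := by
    exact_mod_cast density_mono (chosen_subset_finalSet P)
  have h₅ := mul_le_mul_of_nonneg_left h₂ hρ.le
  linarith

/-! ### The encodings -/

theorem encodeNats_nil : encodeNats [] = [] := rfl

theorem encodeNats_cons (a : ℕ) (l : List ℕ) :
    encodeNats (a :: l) = (Computability.encodeNat a).map some ++ none :: encodeNats l := by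
  simp [encodeNats]

theorem encodeNats_append (l l' : List ℕ) : encodeNats (l ++ l') = encodeNats l ++ encodeNats l' :=
  List.flatMap_append

theorem encodeNats_flatMap {α : Type*} (l : List α) (f : α → List ℕ) :
    encodeNats (l.flatMap f) = l.flatMap fun a => encodeNats (f a) :=
  List.flatMap_assoc

theorem encodeNats_map {α : Type*} (l : List α) (f : α → ℕ) :
    encodeNats (l.map f) = l.flatMap fun a => encodeNats [f a] := by
  rw [← encodeNats_flatMap, List.map_eq_flatMap]

/-- `finProdFinEquiv` numbers pairs lexicographically. Voters therefore appear in the order of the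
entries of the adjacency matrix, and no index arithmetic is needed in the programs. -/
theorem flatMap_finRange_mul {α : Type*} (n : ℕ) (f : Fin (n * n) → List α) :
    (List.finRange (n * n)).flatMap f = (List.finRange n).flatMap fun a =>
      (List.finRange n).flatMap fun b => f (finProdFinEquiv (a, b)) := by
  have : List.finRange (n * n) = (List.finRange n).flatMap fun a =>
      (List.finRange n).map fun b => finProdFinEquiv (a, b) := by
    rw [← List.ofFn_id, List.ofFn_mul, List.flatMap, ← List.ofFn_eq_map]
    congr 2
    funext a
    rw [← List.ofFn_eq_map]
    congr 1
    funext b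
    apply Fin.ext
    simp [finProdFinEquiv]
    ring
  rw [this, List.flatMap_assoc]
  simp [List.flatMap_map]

/-- The code of an entry of an adjacency matrix. -/
def bitCode (b : Bool) : List (Option Bool) := if b then [some true, none] else [none]

/-- The binary code of `0` is empty, so a zero is written as a separator alone. -/
theorem encodeNats_singleton_bit (b : Prop) [Decidable b] :
    encodeNats [if b then 1 else 0] = bitCode (decide b) := by
  by_cases h : b <;> simp [h, bitCode] <;> rfl

/-- The code of a pair of voters. -/
def edgeCode (b : Bool) : List (Option Bool) :=
  bitCode b ++ [some true, none, some true, none]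

/-- The code of the scores of a voter. -/
def scoreCode (b : Bool) : List (Option Bool) :=
  if b then [none, some false, some true, none] else [some true, none, none]

open Classical in
theorem encodeDkSInstance_eq (I : DkSInstance) :
    encodeDkSInstance I = (Computability.encodeNat I.n).map some ++ none ::
      ((Computability.encodeNat I.k).map some ++ none ::
      ((List.finRange I.n).flatMap fun a => (List.finRange I.n).flatMap fun b =>
        bitCode (decide (I.G.Adj a b)))) := by
  unfold encodeDkSInstance
  rw [List.cons_append, List.singleton_append, encodeNats_cons, encodeNats_cons,
    encodeNats_flatMap]
  simp only [encodeNats_map, encodeNats_singleton_bit]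

-- The network part depends on `n` alone; the graph enters only through the scores, one block for
-- each matrix entry.
open Classical in
theorem encodeECSInstance_reduction (I : DkSInstance) :
    encodeECSInstance (reduction I) = (Computability.encodeNat (I.n * I.n)).map some ++ none ::
      ((Computability.encodeNat I.k).map some ++ none ::
      (((List.finRange I.n).flatMap fun a => (List.finRange I.n).flatMap fun b =>
        (List.finRange I.n).flatMap fun c => (List.finRange I.n).flatMap fun d =>
          edgeCode (decide (b = a) && (decide (c = a) || decide (d = a)))) ++
      ((List.finRange I.n).flatMap fun a => (List.finRange I.n).flatMap fun b =>
        scoreCode (decide (I.G.Adj a b))))) := by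
  have h₁ : ∀ u v : Fin (reduction I).n,
      encodeNats [if (u, v) ∈ (reduction I).E then 1 else 0, ((reduction I).p (u, v)).num.toNat,
        ((reduction I).p (u, v)).den] = edgeCode (decide ((u, v) ∈ (reduction I).E)) := by
    intro u v
    have : (reduction I).p (u, v) = 1 := rfl
    rw [this]
    by_cases h : (u, v) ∈ (reduction I).E <;> simp [h, edgeCode, bitCode] <;> rfl
  have h₂ : ∀ a b : Fin I.n, encodeNats ((List.finRange (1 + 1)).map fun i =>
      (reduction I).π (voter a b) i) = scoreCode (decide (I.G.Adj a b)) := by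
    intro a b
    by_cases h : I.G.Adj a b
    · simp only [reduction_π_of_adj h, h, scoreCode]; rfl
    · simp only [reduction_π_of_not_adj h, h, scoreCode]; rfl
  unfold encodeECSInstance
  rw [List.append_assoc, List.cons_append, List.singleton_append, encodeNats_cons, encodeNats_cons,
    encodeNats_append, encodeNats_flatMap, encodeNats_flatMap]
  simp only [encodeNats_flatMap, h₁]
  have e₁ : ((List.finRange (reduction I).n).flatMap fun u =>
      (List.finRange (reduction I).n).flatMap fun v =>
        edgeCode (decide ((u, v) ∈ (reduction I).E))) =
      (List.finRange I.n).flatMap fun a => (List.finRange I.n).flatMap fun b =>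
        (List.finRange I.n).flatMap fun c => (List.finRange I.n).flatMap fun d =>
          edgeCode (decide (b = a) && (decide (c = a) || decide (d = a))) := by
    refine (flatMap_finRange_mul I.n _).trans ?_
    refine List.flatMap_congr fun a _ => List.flatMap_congr fun b _ => ?_
    refine (flatMap_finRange_mul I.n _).trans ?_
    refine List.flatMap_congr fun c _ => List.flatMap_congr fun d _ => ?_
    congr 1
    rw [← Bool.decide_or, ← Bool.decide_and, decide_eq_decide]
    refine mem_reduction_E.trans ?_
    simp only [eq_comm]
  have e₂ : ((List.finRange (reduction I).n).flatMap fun v =>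
      encodeNats ((List.finRange (1 + 1)).map fun i => (reduction I).π v i)) =
      (List.finRange I.n).flatMap fun a => (List.finRange I.n).flatMap fun b =>
        scoreCode (decide (I.G.Adj a b)) := by
    refine (flatMap_finRange_mul I.n _).trans ?_
    exact List.flatMap_congr fun a _ => List.flatMap_congr fun b _ => h₂ a b
  rw [e₁, e₂]
  rfl

/-- The code of a voter in a seed plan. -/
def seedCode {ℓ : ℕ} : Option (Fin (ℓ + 1) → ℤ) → List (Option Bool)
  | none => [none]
  | some m => [some true, none] ++
      (List.finRange (ℓ + 1)).flatMap fun i => encodeNats [Equiv.intEquivNat (m i)]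

theorem encodeSeedPlan_eq {ℓ n : ℕ} (P : SeedPlan ℓ n) :
    encodeSeedPlan ⟨n, P⟩ = (Computability.encodeNat n).map some ++ none ::
      (List.finRange n).flatMap fun s => seedCode (P s) := by
  unfold encodeSeedPlan
  rw [encodeNats_cons, encodeNats_flatMap]
  congr 2
  refine List.flatMap_congr fun s _ => ?_
  cases h : P s with
  | none => simp only [h]; rfl
  | some m =>
    simp only [h, seedCode]
    rw [encodeNats_cons, encodeNats_map]
    rfl

theorem encodeVertexSet_finalSet (P : SeedPlan 1 (reduction I).n) :
    encodeVertexSet ⟨I.n, finalSet P⟩ = (Computability.encodeNat I.n).map some ++ none ::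
      (finalBits P).flatMap bitCode := by
  unfold encodeVertexSet
  rw [encodeNats_cons, encodeNats_map]
  simp only [encodeNats_singleton_bit]
  congr 2
  conv_rhs => rw [← map_finRange_getD (length_finalBits P), List.flatMap_map]
  refine List.flatMap_congr fun v _ => ?_
  simp [finalSet]

end ElectionControl

/-! ### Stack programs for constant strings, one-hot vectors and Boolean bilinear forms. -/

namespace StackProgram

open Function

variable {K : Type} [DecidableEq K] {R : List (Option Bool) → List (Option Bool) → ℕ → Prop}

/-! ### Emitting strings -/

/-- Pushes the symbols of a string. -/
def pushAll (o : K) : List (Option Bool) → Prog K (Option Bool)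
  | [] => .skip
  | a :: w => .push o a ;; pushAll o w

theorem emits_pushAll {o : K} (w : List (Option Bool)) :
    Emits R (fun _ => True) (pushAll o w) o w (w.length + 1) := by
  induction w with
  | nil => exact Emits.skip
  | cons a w ih =>
    intro s hs
    exact ((Emits.push (a := a)).seq (fun _ _ _ => trivial) ih s hs).mono
      (by simp only [List.length_cons]; omega)

theorem Emits.weaken {P Q : (K → List (Option Bool)) → Prop} {p : Prog K (Option Bool)} {o : K}
    {w : List (Option Bool)} {C C' : ℕ} (h : Emits R P p o w C) (hQ : ∀ s, Q s → P s)
    (hC : C ≤ C') : Emits R Q p o w C' :=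
  fun s hs => (h s (hQ s hs)).mono hC

/-! ### One-hot vectors -/

/-- The vector of length `n` with a single bit `true`, at position `i`. -/
def hot (n i : ℕ) : List (Option Bool) := (List.finRange n).map fun j => some (decide (j.1 = i))

@[simp] theorem length_hot (n i : ℕ) : (hot n i).length = n := by simp [hot]

theorem cons_dropLast_hot (n i : ℕ) :
    some false :: (hot (n + 1) i).dropLast = hot (n + 1) (i + 1) := by
  apply List.ext_getElem
  · simp [hot]
  · intro j h₁ h₂
    cases j with
    | zero => simp [hot]
    | succ j => simp [hot]

/-- Pushes the vector `hot n 0` to the stack `h`, where `n` is the length of the stack `u`. -/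
def initHot (u t h : K) : Prog K (Option Bool) :=
  each u t (fun _ => .push h (some false)) ;; .branch h fun
    | none => .skip
    | some _ => .pop h ;; .push h (some true)

theorem exec_initHot {u t h : K} (hut : u ≠ t) (huh : u ≠ h) (hth : t ≠ h)
    {s : K → List (Option Bool)} {n : ℕ} (hu : s u = List.replicate n (some true))
    (ht : s t = []) (hh : s h = []) :
    Exec R (initHot u t h) s (update s h (hot n 0)) (5 * n + 5) := by
  have h₁ := exec_each_push (R := R) hut huh hth (g := fun _ => some false) hu ht
  simp only [List.map_replicate, List.reverse_replicate, hh, List.append_nil,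
    List.length_replicate] at h₁
  refine (h₁.seq (Exec.branch (t := 2) (s' := update s h (hot n 0)) ?_)).of_eq rfl (by omega)
  cases n with
  | zero => simpa [hot] using (Exec.skip (R := R)).mono one_le_two
  | succ n =>
    simp only [update_self, List.replicate_succ, List.head?_cons]
    refine (Exec.pop.seq Exec.push).of_eq ?_ le_rfl
    simp only [update_self, List.tail_cons, update_idem]
    congr 1
    apply List.ext_getElem
    · simp [hot]
    · intro j h₁ h₂
      cases j <;> simp [hot]

/-! ### Bilinear forms -/

/-- Executed for a row: looks for a common `true` in the stack `y` and in the next row of the matrix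
on the stack `m`, and records it on the stack `acc` if `x` is `true`. The row is moved to the stack
`w`. -/
def scanRow (y ty m w acc : K) (x : Option Bool) : Prog K (Option Bool) :=
  each y ty fun b => .branch m fun
    | none => .skip
    | some e => .pop m ;; .push w e ;;
        if x = some true ∧ b = some true ∧ e = some true then .push acc (some true) else .skip

/-- Looks for an entry `true` of the matrix on the stack `m` whose row is `true` in the stack `x`
and whose column is `true` in the stack `y`, and records it on the stack `acc`. -/
def scan (x tx y ty m w acc : K) : Prog K (Option Bool) :=
  each x tx (scanRow y ty m w acc) ;; move w m

/-- The hits of `scanRow`. -/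
def rowHits {β : Type*} (l : List β) (a : Bool) (η : β → Bool) (σ : β → Bool) :
    List (Option Bool) :=
  l.flatMap fun b => if a && η b && σ b then [some true] else []

theorem exec_scanRow {y ty m w acc : K} (hnd : [y, ty, m, w, acc].Nodup) {β : Type*} {l : List β}
    {a : Bool} {η σ : β → Bool} {s : K → List (Option Bool)} {r : List (Option Bool)}
    (hy : s y = l.map fun b => some (η b)) (hty : s ty = [])
    (hm : s m = (l.map fun b => some (σ b)) ++ r) :
    Exec R (scanRow y ty m w acc (some a)) s
      (update (update (update s m r) w ((l.map fun b => some (σ b)).reverse ++ s w)) acc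
        ((rowHits l a η σ).reverse ++ s acc)) (l.length * 8 + 2) := by
  simp only [List.nodup_cons, List.mem_cons, List.not_mem_nil, or_false, not_or,
    List.nodup_nil, and_true, not_false_eq_true] at hnd
  obtain ⟨⟨y₁, y₂, y₃, y₄⟩, ⟨z₁, z₂, z₃⟩, ⟨m₁, m₂⟩, w₁⟩ := hnd
  refine exec_each (ξ := fun b => some (η b)) (l := l) (C := 4) (S := fun l₁ l₂ =>
    update (update (update s m ((l₂.map fun b => some (σ b)) ++ r)) w
      ((l₁.map fun b => some (σ b)).reverse ++ s w)) acc ((rowHits l₁ a η σ).reverse ++ s acc))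
    y₁ ?_ rfl hy hty ?_ ?_ ?_
  · simp [rowHits, ← hm]
  · simpa [y₂, y₃, y₄] using hy
  · simpa [z₁, z₂, z₃] using hty
  · intro l₁ b l₂ hl p q
    refine Exec.branch (t := 3) ?_
    simp only [ne_eq, Ne.symm z₁, Ne.symm y₂, m₁, m₂, not_false_eq_true, update_of_ne,
      update_self, List.map_cons, List.cons_append, List.head?_cons]
    by_cases h : a = true ∧ η b = true ∧ σ b = true
    · rw [if_pos (by simpa using h)]
      refine (Exec.pop.seq (Exec.push.seq Exec.push)).of_eq ?_ le_rfl
      funext j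
      simp only [update_apply, rowHits, List.flatMap_append, List.map_append]
      grind
    · rw [if_neg (by simpa using h)]
      refine (Exec.pop.seq (Exec.push.seq Exec.skip)).of_eq ?_ le_rfl
      funext j
      simp only [update_apply, rowHits, List.flatMap_append, List.map_append]
      grind

/-- The matrix passes to `w` row by row in reversed order, and the final move restores it. Suitable
vectors on `x` and `y` select an entry, a row or a column, which replaces random access. -/
theorem exec_scan {x tx y ty m w acc : K} (hnd : [x, tx, y, ty, m, w, acc].Nodup) {α β : Type*}
    {l : List α} {l' : List β} {ξ : α → Bool} {η : β → Bool} {σ : α → β → Bool}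
    {s : K → List (Option Bool)} (hx : s x = l.map fun a => some (ξ a)) (htx : s tx = [])
    (hy : s y = l'.map fun b => some (η b)) (hty : s ty = [])
    (hm : s m = l.flatMap fun a => l'.map fun b => some (σ a b)) (hw : s w = []) :
    Exec R (scan x tx y ty m w acc) s
      (update s acc ((l.flatMap fun a => rowHits l' (ξ a) η (σ a)).reverse ++ s acc))
      (l.length * (10 * l'.length + 6) + 3) := by
  have hnd' : [y, ty, m, w, acc].Nodup := (List.nodup_cons.1 (List.nodup_cons.1 hnd).2).2
  simp only [List.nodup_cons, List.mem_cons, List.not_mem_nil, or_false, not_or,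
    List.nodup_nil, and_true, not_false_eq_true] at hnd
  obtain ⟨⟨x₁, x₂, x₃, x₄, x₅, x₆⟩, ⟨u₁, u₂, u₃, u₄, u₅⟩, ⟨y₁, y₂, y₃, y₄⟩, ⟨z₁, z₂, z₃⟩,
    ⟨m₁, m₂⟩, w₁⟩ := hnd
  set E : List α → List (Option Bool) := fun l => l.flatMap fun a => l'.map fun b => some (σ a b)
    with hE
  have hstart : s = update (update (update s m (E l)) w (E []).reverse) acc
      ((([] : List α).flatMap fun a => rowHits l' (ξ a) η (σ a)).reverse ++ s acc) := by
    rw [show E l = s m from hm.symm, update_eq_self, show (E []).reverse = s w from hw.symm,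
      update_eq_self]
    simp
  have h₁ := exec_each (R := R) (body := scanRow y ty m w acc) (ξ := fun a => some (ξ a)) (l := l)
    (C := l'.length * 8 + 2) (s := s)
    (S := fun l₁ l₂ => update (update (update s m (E l₂)) w (E l₁).reverse) acc
      ((l₁.flatMap fun a => rowHits l' (ξ a) η (σ a)).reverse ++ s acc))
    x₁ hstart rfl hx htx
    (by simpa [x₄, x₅, x₆] using hx) (by simpa [u₃, u₄, u₅] using htx) ?_
  · have h₂ := exec_move (R := R) (Ne.symm m₁) (x := (E l).reverse)
      (s := update (update (update s m (E [])) w (E l).reverse) acc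
        ((l.flatMap fun a => rowHits l' (ξ a) η (σ a)).reverse ++ s acc)) (by simp [w₁])
    refine (h₁.seq h₂).of_eq ?_ ?_
    · funext j
      simp only [update_apply]
      grind
    · have : (E l).length = l.length * l'.length := by simp [hE]
      rw [List.length_reverse, this]
      apply le_of_eq
      ring
  · intro l₁ a l₂ hl p q
    refine (exec_scanRow hnd' (l := l') (η := η) (σ := σ a) (a := ξ a) (r := E l₂)
      ?_ ?_ ?_).of_eq ?_ le_rfl
    · simp only [update_apply]
      grind
    · simp only [update_apply]
      grind
    · simp only [update_apply]
      grind
    · funext j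
      simp only [update_apply, hE, List.flatMap_append]
      grind

/-- Pushes whether something has been recorded on the stack `acc`, and empties it. -/
def flush (acc o : K) : Prog K (Option Bool) :=
  .branch acc (fun
    | none => .push o (some false)
    | some _ => .push o (some true)) ;; clear acc

theorem exec_flush {acc o : K} (h : acc ≠ o) {s : K → List (Option Bool)}
    {x : List (Option Bool)} (hx : s acc = x) :
    Exec R (flush acc o) s (update (update s acc []) o (some (decide (x ≠ [])) :: s o))
      (2 * x.length + 3) := by
  have h₁ : Exec R (.branch acc (fun
    | none => .push o (some false)
    | some _ => .push o (some true))) s (update s o (some (decide (x ≠ [])) :: s o)) 2 := by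
    refine Exec.branch (t := 1) ?_
    rw [hx]
    cases x with
    | nil => simpa using Exec.push (R := R) (k := o)
    | cons a x => simpa using Exec.push (R := R) (k := o)
  refine (h₁.seq (exec_clear (x := x) (by simpa [h] using hx))).of_eq ?_ (by omega)
  rw [update_comm h]

end StackProgram

/-! ### Reading the graph and writing the election. -/

namespace ElectionControl

open StackProgram Computability Function

/-! ### The memory of the algorithm -/

/-- The stacks of the algorithm. -/
inductive Stk
  | inp | nR | kR | adj | bits | cnt | u | uk | h1 | h2 | h3 | out | res
  | ctl | tmp | t0 | t1 | t2 | t3 | acc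
  deriving DecidableEq

instance : Fintype Stk :=
  ⟨{.inp, .nR, .kR, .adj, .bits, .cnt, .u, .uk, .h1, .h2, .h3, .out, .res, .ctl, .tmp, .t0, .t1,
    .t2, .t3, .acc}, fun j => by cases j <;> decide⟩

/-- A content of the stacks in which the auxiliary ones are empty. -/
structure Store where
  inp : List (Option Bool) := []
  nR : List (Option Bool) := []
  kR : List (Option Bool) := []
  adj : List (Option Bool) := []
  bits : List (Option Bool) := []
  cnt : List (Option Bool) := []
  u : List (Option Bool) := []
  uk : List (Option Bool) := []
  h1 : List (Option Bool) := []
  h2 : List (Option Bool) := []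
  h3 : List (Option Bool) := []
  out : List (Option Bool) := []
  res : List (Option Bool) := []

/-- The content of the stacks as a function. -/
def Store.fn (m : Store) : Stk → List (Option Bool)
  | .inp => m.inp
  | .nR => m.nR
  | .kR => m.kR
  | .adj => m.adj
  | .bits => m.bits
  | .cnt => m.cnt
  | .u => m.u
  | .uk => m.uk
  | .h1 => m.h1
  | .h2 => m.h2
  | .h3 => m.h3
  | .out => m.out
  | .res => m.res
  | _ => []

variable {R : List (Option Bool) → List (Option Bool) → ℕ → Prop}

/-- The bits of a square matrix, row by row. -/
def matrixBits {n : ℕ} (f : Fin n → Fin n → Bool) : List Bool :=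
  (List.finRange n).flatMap fun a => (List.finRange n).map (f a)

@[simp] theorem length_matrixBits {n : ℕ} (f : Fin n → Fin n → Bool) :
    (matrixBits f).length = n * n := by
  simp [matrixBits]

theorem flatMap_matrixBits {n : ℕ} {α : Type*} (f : Fin n → Fin n → Bool) (g : Bool → List α) :
    (matrixBits f).flatMap g = (List.finRange n).flatMap fun a =>
      (List.finRange n).flatMap fun b => g (f a b) := by
  simp [matrixBits, List.flatMap_assoc, List.flatMap_map]

theorem map_matrixBits {n : ℕ} {α : Type*} (f : Fin n → Fin n → Bool) (g : Bool → α) :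
    (matrixBits f).map g = (List.finRange n).flatMap fun a =>
      (List.finRange n).map fun b => g (f a b) := by
  simp [matrixBits, List.map_flatMap, Function.comp_def]

/-! ### Reading the graph -/

/-- Reads the adjacency matrix. -/
def readMatrix : Prog Stk (Option Bool) :=
  .loop .inp fun
    | none => .push .adj (some false)
    | some _ => .pop .inp ;; .push .adj (some true)

theorem exec_readMatrix (l : List Bool) (m : Store) (h : m.inp = l.flatMap bitCode) :
    Exec R readMatrix m.fn {m with inp := [], adj := (l.map some).reverse ++ m.adj}.fn
      (3 * l.length + 1) := by
  induction l generalizing m with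
  | nil =>
    refine (Exec.loop_nil (k := Stk.inp) (s := m.fn) h).of_eq ?_ le_rfl
    funext j
    cases j <;> simp [Store.fn, h]
  | cons b l ih =>
    cases b with
    | false =>
      have ih' := ih {m with inp := l.flatMap bitCode, adj := some false :: m.adj} rfl
      have hb : Exec R (.push .adj (some false)) (update m.fn .inp (l.flatMap bitCode))
          {m with inp := l.flatMap bitCode, adj := some false :: m.adj}.fn 1 := by
        refine Exec.push.of_eq ?_ le_rfl
        funext j; cases j <;> simp [Store.fn]
      refine (Exec.loop_cons (k := Stk.inp) (s := m.fn) (x := none) (xs := l.flatMap bitCode)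
        (b := fun
          | none => .push .adj (some false)
          | some _ => .pop .inp ;; .push .adj (some true))
        (by simpa [Store.fn, bitCode] using h) hb ih').of_eq ?_ ?_
      · simp
      · simp only [List.length_cons]; omega
    | true =>
      have ih' := ih {m with inp := l.flatMap bitCode, adj := some true :: m.adj} rfl
      refine (Exec.loop_cons (k := Stk.inp) (s := m.fn) (x := some true)
        (xs := none :: l.flatMap bitCode) (t := 2)
        (by simpa [Store.fn, bitCode] using h)
        ((Exec.pop.seq Exec.push).of_eq ?_ le_rfl) ih').of_eq ?_ ?_
      · funext j; cases j <;> simp [Store.fn]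
      · simp
      · simp only [List.length_cons]; omega

/-- Reverses the list of matrix entries and counts them. -/
def countEntries : Prog Stk (Option Bool) :=
  .loop .adj fun x => .push .bits x ;; increment .cnt .tmp .ctl

/-- Counting the matrix entries yields the number of voters `n * n` in binary without a
multiplication. The bound `N` on the counter makes the cost per entry uniform. -/
theorem exec_countEntries (l : List (Option Bool)) (c N : ℕ) (m : Store) (h : m.adj = l)
    (hc : m.cnt = (encodeNat c).map some) (hN : c + l.length ≤ N) :
    Exec R countEntries m.fn {m with
      adj := [], bits := l.reverse ++ m.bits, cnt := (encodeNat (c + l.length)).map some}.fn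
      (l.length * (7 * N + 9) + 1) := by
  induction l generalizing m c with
  | nil =>
    refine (Exec.loop_nil (k := Stk.adj) (s := m.fn) h).of_eq ?_ (by simp)
    funext j
    cases j <;> simp [Store.fn, h, hc]
  | cons b l ih =>
    have ih' := ih (c + 1) {m with
      adj := l, bits := b :: m.bits, cnt := (encodeNat (c + 1)).map some} rfl rfl
      (by simp at hN; omega)
    have hi := exec_increment (R := R) (k := Stk.cnt) (t := .tmp) (c := .ctl)
      (s := {m with adj := l, bits := b :: m.bits}.fn) (l := encodeNat c)
      (by decide) (by decide) (by decide) hc rfl rfl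
    have hlen := length_encodeNat_le c
    refine (Exec.loop_cons (k := Stk.adj) (s := m.fn) (x := b) (xs := l) (t := 7 * N + 8)
      h ((Exec.push.seq (hi.of_start_eq ?_)).of_eq ?_ ?_) ih').of_eq ?_ ?_
    · funext j; cases j <;> simp [Store.fn]
    · funext j; cases j <;> simp [Store.fn, encodeNat_succ]
    · simp at hN; omega
    · simp [add_assoc, add_comm 1]
    · simp only [List.length_cons]
      apply le_of_eq
      ring

/-! ### Writing the network -/

/-- The code of the network of the reduction. -/
def networkCode (n : ℕ) : List (Option Bool) :=
  (List.finRange n).flatMap fun a => (List.finRange n).flatMap fun b =>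
    (List.finRange n).flatMap fun c => (List.finRange n).flatMap fun d =>
      edgeCode (decide (b = a) && (decide (c = a) || decide (d = a)))

/-- Writes the rows of the network that belong to one vertex. -/
def writeRows : Prog Stk (Option Bool) :=
  each .h1 .t1 fun x => each .h2 .t2 fun y => each .h3 .t3 fun z =>
    pushAll .out (edgeCode (decide (x = some true) &&
      (decide (y = some true) || decide (z = some true))))

theorem length_flatMap_finRange_le {α : Type*} {n C : ℕ} {f : Fin n → List α}
    (h : ∀ i, (f i).length ≤ C) : ((List.finRange n).flatMap f).length ≤ n * C := by
  rw [List.length_flatMap]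
  refine (List.sum_le_card_nsmul _ C ?_).trans (by simp)
  intro x hx
  obtain ⟨i, -, rfl⟩ := List.mem_map.1 hx
  exact h i

theorem length_edgeCode_le (b : Bool) : (edgeCode b).length ≤ 6 := by
  cases b <;> simp [edgeCode, bitCode]

/-- Iterating over a one-hot vector for `a` means that the symbol read already tells whether the
current index is `a`. Each of the three nested loops holds its own stack, hence three copies of the
vector. -/
theorem emits_writeRows {n : ℕ} (a : Fin n) :
    Emits R (fun s : Stk → List (Option Bool) => (s .h1 = hot n a ∧ s .t1 = []) ∧
        (s .h2 = hot n a ∧ s .t2 = []) ∧ (s .h3 = hot n a ∧ s .t3 = [])) writeRows .out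
      ((List.finRange n).flatMap fun b => (List.finRange n).flatMap fun c =>
        (List.finRange n).flatMap fun d =>
          edgeCode (decide (b = a) && (decide (c = a) || decide (d = a))))
      (n * (n * (n * 11 + 6) + 6) + 2) := by
  have e : ∀ j : Fin n, (decide (some (decide (j.1 = a.1)) = some true)) = decide (j = a) := by
    intro j
    simp [Fin.ext_iff]
  refine (Emits.each (ξ := fun j : Fin n => some (decide (j.1 = a.1))) (l := List.finRange n)
    (Q := fun s => (s .h2 = hot n a ∧ s .t2 = []) ∧ (s .h3 = hot n a ∧ s .t3 = []))
    (C := n * (n * 11 + 6) + 2)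
    (by decide) (by decide) (by decide) (fun s hs => hs.1) (fun s _ _ _ hs => by simpa using hs.2)
    fun b _ => ?_).weaken (fun _ h => h) (by simp)
  refine (Emits.each (ξ := fun j : Fin n => some (decide (j.1 = a.1))) (l := List.finRange n)
    (Q := fun s => s .h3 = hot n a ∧ s .t3 = []) (C := n * 11 + 2)
    (by decide) (by decide) (by decide) (fun s hs => hs.1) (fun s _ _ _ hs => by simpa using hs.2)
    fun c _ => ?_).weaken (fun _ h => h) (by simp)
  refine (Emits.each (ξ := fun j : Fin n => some (decide (j.1 = a.1))) (l := List.finRange n)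
    (Q := fun s => True) (C := 7)
    (by decide) (by decide) (by decide) (fun s hs => hs) (fun s _ _ _ _ => trivial)
    fun d _ => ?_).weaken (fun _ h => h) (by simp)
  rw [e, e, e]
  exact (emits_pushAll _).weaken (fun _ h => h) (Nat.succ_le_succ (length_edgeCode_le _))

/-- Writes the network. -/
def writeNetwork : Prog Stk (Option Bool) :=
  each .u .t0 fun _ => writeRows ;; shift (some false) .h1 .t1 ;; shift (some false) .h2 .t2 ;;
    shift (some false) .h3 .t3

/-- Links a loop invariant, which counts finished rounds, to the current vertex. -/
theorem length_of_finRange_eq {n : ℕ} {l₁ l₂ : List (Fin n)} {a : Fin n}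
    (h : List.finRange n = l₁ ++ a :: l₂) : l₁.length = a.1 := by
  have h₁ : (List.finRange n)[l₁.length]? = some a := by rw [h]; simp
  obtain ⟨hlt, h₂⟩ := List.getElem?_eq_some_iff.1 h₁
  rw [List.getElem_finRange] at h₂
  rw [← h₂]
  rfl

theorem exec_shift_hot {k t : Stk} (hkt : k ≠ t) {s : Stk → List (Option Bool)} {n i : ℕ}
    (hn : n ≠ 0) (hk : s k = hot n i) (ht : s t = []) :
    Exec R (shift (some false) k t) s (update s k (hot n (i + 1))) (4 * n + 4) := by
  obtain ⟨n, rfl⟩ := Nat.exists_eq_succ_of_ne_zero hn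
  refine (exec_shift (a := some false) hkt hk ht).of_eq ?_ (by simp)
  rw [Nat.succ_eq_add_one, cons_dropLast_hot]

theorem exec_writeNetwork (n : ℕ) (m : Store) (hu : m.u = List.replicate n (some true))
    (h₁ : m.h1 = hot n 0) (h₂ : m.h2 = hot n 0) (h₃ : m.h3 = hot n 0) :
    Exec R writeNetwork m.fn {m with
      h1 := hot n n, h2 := hot n n, h3 := hot n n, out := (networkCode n).reverse ++ m.out}.fn
      (n * (n * (n * (n * 11 + 6) + 6) + 12 * n + 18) + 2) := by
  set row : Fin n → List (Option Bool) := fun a => (List.finRange n).flatMap fun b =>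
    (List.finRange n).flatMap fun c => (List.finRange n).flatMap fun d =>
      edgeCode (decide (b = a) && (decide (c = a) || decide (d = a))) with hrow
  refine (exec_each (ξ := fun _ => some true) (l := List.finRange n)
    (C := n * (n * (n * 11 + 6) + 6) + 12 * n + 14)
    (S := fun l₁ _ => {m with
      h1 := hot n l₁.length, h2 := hot n l₁.length, h3 := hot n l₁.length,
      out := (l₁.flatMap row).reverse ++ m.out}.fn)
    (by decide) ?_ ?_ ?_ rfl ?_ rfl ?_).mono (by simp)
  · funext j; cases j <;> simp [Store.fn, h₁, h₂, h₃]
  · funext j; cases j <;> simp [Store.fn, networkCode, hrow]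
  · simpa [Store.fn] using hu
  · simpa [Store.fn] using hu
  · intro l₁ a l₂ hl x y
    have ha := length_of_finRange_eq hl
    -- On an empty vector `shift` would add a symbol instead of keeping the length; the vertex `a`
    -- rules this case out.
    have hn : n ≠ 0 := Nat.ne_of_gt (lt_of_le_of_lt (Nat.zero_le _) a.2)
    rw [List.length_append, ha]
    have hs := emits_writeRows (R := R) a (update (update
      {m with
        h1 := hot n a.1, h2 := hot n a.1, h3 := hot n a.1,
        out := (l₁.flatMap row).reverse ++ m.out}.fn .u x) .t0 y) (by simp [Store.fn])
    refine (hs.seq ((exec_shift_hot (n := n) (i := a.1) ?_ hn ?_ ?_).seq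
      ((exec_shift_hot (n := n) (i := a.1) ?_ hn ?_ ?_).seq
        (exec_shift_hot (n := n) (i := a.1) ?_ hn ?_ ?_)))).of_eq ?_ (by omega)
    · decide
    · simp [Store.fn]
    · simp [Store.fn]
    · decide
    · simp [Store.fn]
    · simp [Store.fn]
    · decide
    · simp [Store.fn]
    · simp [Store.fn]
    · funext j; cases j <;> simp [Store.fn, hrow]

/-- Writes the scores of the voters. -/
def writeScores : Prog Stk (Option Bool) :=
  .loop .bits fun x => pushAll .out (scoreCode (decide (x = some true)))

theorem exec_writeScores (l : List Bool) (m : Store) (h : m.bits = l.map some) :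
    Exec R writeScores m.fn {m with bits := [], out := (l.flatMap scoreCode).reverse ++ m.out}.fn
      (6 * l.length + 1) := by
  induction l generalizing m with
  | nil =>
    refine (Exec.loop_nil (k := Stk.bits) (s := m.fn) h).of_eq ?_ le_rfl
    funext j
    cases j <;> simp [Store.fn, h]
  | cons b l ih =>
    have ih' := ih {m with bits := l.map some, out := (scoreCode b).reverse ++ m.out} rfl
    refine (Exec.loop_cons (k := Stk.bits) (s := m.fn) (x := some b) (xs := l.map some) (t := 5) h
      ((emits_pushAll _ _ trivial).of_eq ?_ ?_) ih').of_eq ?_ ?_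
    · funext j; cases j <;> simp [Store.fn]
    · cases b <;> simp [scoreCode]
    · simp
    · simp only [List.length_cons]; omega

end ElectionControl

/-! ### The reduction in polynomial time. -/

namespace ElectionControl

open StackProgram Computability Function

variable {R : List (Option Bool) → List (Option Bool) → ℕ → Prop}

/-! ### The reduction as a program -/

/-- Turns the code of a graph on the stack `inp` into the code of an election on the stack `out`. -/
def reductionProg : Prog Stk (Option Bool) :=
  readNum .inp .nR .ctl ;; readNum .inp .kR .ctl ;; readMatrix ;; countEntries ;;
  toUnary .nR .t0 .u .tmp ;; toUnary .kR .t0 .uk .tmp ;;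
  initHot .u .t0 .h1 ;; initHot .u .t0 .h2 ;; initHot .u .t0 .h3 ;;
  move .cnt .out ;; .push .out none ;; move .kR .res ;; move .res .out ;; .push .out none ;;
  writeNetwork ;; writeScores ;; clear .h1 ;; clear .h2 ;; clear .h3

/-- The running time of `reductionProg`. -/
def reductionTime {A : Type*} [CommSemiring A] (n : A) : A :=
  5 * n + 5 + (5 * n + 5 + (3 * (n * n) + 1 + (n * n * (7 * (n * n) + 9) + 1 +
  (n * (7 * n + 7) + 2 + (n * (7 * n + 7) + 2 + (5 * n + 5 + (5 * n + 5 + (5 * n + 5 +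
  (2 * (n * n) + 1 + (1 + (2 * n + 1 + (2 * n + 1 + (1 +
  (n * (n * (n * (n * 11 + 6) + 6) + 12 * n + 18) + 2 + (6 * (n * n) + 1 +
  (2 * n + 1 + (2 * n + 1 + (2 * n + 1))))))))))))))))))

-- The output is left reversed, as `call` requires. The copy of `n` in binary and the unary copies
-- of `n` and `k` stay in memory for the extraction after the call.
open Classical in
theorem exec_reductionProg (I : DkSInstance) :
    Exec R reductionProg {inp := encodeDkSInstance I : Store}.fn
      { nR := ((encodeNat I.n).map some).reverse
        u := List.replicate I.n (some true)
        uk := List.replicate I.k (some true)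
        out := (encodeECSInstance (reduction I)).reverse : Store }.fn (reductionTime I.n) := by
  have hk := I.k_le
  set n := I.n with hn
  set k := I.k with hk'
  set f : Fin n → Fin n → Bool := fun a b => decide (I.G.Adj a b) with hf
  have len_n := length_encodeNat_le n
  have len_k : (encodeNat k).length ≤ n := (length_encodeNat_le k).trans hk
  have len_N := length_encodeNat_le (n * n)
  set rn := ((encodeNat n).map some).reverse with hrn
  set rk := ((encodeNat k).map some).reverse with hrk
  have hinp : encodeDkSInstance I = (encodeNat n).map some ++ none ::
      ((encodeNat k).map some ++ none :: (matrixBits f).flatMap bitCode) := by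
    rw [encodeDkSInstance_eq, flatMap_matrixBits]
  have hval : ∀ i, bitsValue (encodeNat i).reverse = i := bitsValue_reverse_encodeNat
  let m₁ : Store := { nR := rn, inp := (encodeNat k).map some ++ none ::
    (matrixBits f).flatMap bitCode }
  have s₁ : Exec R (readNum .inp .nR .ctl) {inp := encodeDkSInstance I : Store}.fn m₁.fn
      (5 * n + 5) := by
    refine Exec.of_eq (exec_readNum (l := encodeNat n) (by decide) (by decide) (by decide) hinp rfl)
      ?_ (by omega)
    funext j; cases j <;> simp [Store.fn, m₁, rn]
  let m₂ : Store := { nR := rn, kR := rk, inp := (matrixBits f).flatMap bitCode }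
  have s₂ : Exec R (readNum .inp .kR .ctl) m₁.fn m₂.fn (5 * n + 5) := by
    refine Exec.of_eq (exec_readNum (l := encodeNat k) (by decide) (by decide) (by decide) rfl rfl)
      ?_ (by omega)
    funext j; cases j <;> simp [Store.fn, m₁, m₂, rk]
  have s₃ := exec_readMatrix (R := R) (matrixBits f) m₂ rfl
  rw [length_matrixBits] at s₃
  have s₄ := exec_countEntries (R := R) _ 0 (n * n)
    {m₂ with inp := [], adj := ((matrixBits f).map some).reverse ++ m₂.adj} rfl rfl (by simp [m₂])
  let m₄ : Store := {
    nR := rn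
    kR := rk
    bits := (matrixBits f).map some
    cnt := (encodeNat (n * n)).map some }
  replace s₄ := s₄.of_eq (s'' := m₄.fn) (t' := n * n * (7 * (n * n) + 9) + 1)
    (by simp [m₂, m₄]) (by simp [m₂])
  let m₅ : Store := { m₄ with u := List.replicate n (some true) }
  have s₅ : Exec R (toUnary .nR .t0 .u .tmp) m₄.fn m₅.fn (n * (7 * n + 7) + 2) := by
    refine Exec.of_eq (exec_toUnary (l := (encodeNat n).reverse) (by decide) (by decide) (by decide)
      (by decide) (by decide) (by decide) (by simp [Store.fn, m₄, rn]) rfl rfl rfl) ?_ ?_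
    · funext j; cases j <;> simp [Store.fn, m₄, m₅, hval]
    · rw [hval, List.length_reverse]
      gcongr
  let m₆ : Store := { m₅ with uk := List.replicate k (some true) }
  have s₆ : Exec R (toUnary .kR .t0 .uk .tmp) m₅.fn m₆.fn (n * (7 * n + 7) + 2) := by
    refine Exec.of_eq (exec_toUnary (l := (encodeNat k).reverse) (by decide) (by decide) (by decide)
      (by decide) (by decide) (by decide) (by simp [Store.fn, m₅, m₄, rk]) rfl rfl rfl) ?_ ?_
    · funext j; cases j <;> simp [Store.fn, m₅, m₆, hval]
    · rw [hval, List.length_reverse]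
      gcongr
  let m₇ : Store := { m₆ with h1 := hot n 0 }
  have s₇ : Exec R (initHot .u .t0 .h1) m₆.fn m₇.fn (5 * n + 5) := by
    refine Exec.of_eq (exec_initHot (n := n) (by decide) (by decide) (by decide) rfl rfl rfl) ?_
      le_rfl
    funext j; cases j <;> simp [Store.fn, m₇]
  let m₈ : Store := { m₇ with h2 := hot n 0 }
  have s₈ : Exec R (initHot .u .t0 .h2) m₇.fn m₈.fn (5 * n + 5) := by
    refine Exec.of_eq (exec_initHot (n := n) (by decide) (by decide) (by decide) rfl rfl rfl) ?_
      le_rfl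
    funext j; cases j <;> simp [Store.fn, m₈]
  let m₉ : Store := { m₈ with h3 := hot n 0 }
  have s₉ : Exec R (initHot .u .t0 .h3) m₈.fn m₉.fn (5 * n + 5) := by
    refine Exec.of_eq (exec_initHot (n := n) (by decide) (by decide) (by decide) rfl rfl rfl) ?_
      le_rfl
    funext j; cases j <;> simp [Store.fn, m₉]
  let m₁₀ : Store := { m₉ with
    cnt := []
    out := ((encodeNat (n * n)).map some).reverse }
  have s₁₀ : Exec R (move .cnt .out) m₉.fn m₁₀.fn (2 * (n * n) + 1) := by
    refine Exec.of_eq (exec_move (x := (encodeNat (n * n)).map some) (by decide) rfl) ?_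
      (by simpa using len_N)
    funext j; cases j <;> simp [Store.fn, m₁₀, m₉, m₈, m₇, m₆, m₅, m₄]
  let m₁₁ : Store := { m₁₀ with out := none :: m₁₀.out }
  have s₁₁ : Exec R (.push .out none) m₁₀.fn m₁₁.fn 1 := by
    refine Exec.of_eq Exec.push ?_ le_rfl
    funext j; cases j <;> simp [Store.fn, m₁₁]
  -- On `kR` the number is already reversed, as it must lie on `out`; one move would undo this, so
  -- it passes through `res`.
  let m₁₂ : Store := { m₁₁ with
    kR := []
    res := rk.reverse }
  have s₁₂ : Exec R (move .kR .res) m₁₁.fn m₁₂.fn (2 * n + 1) := by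
    refine Exec.of_eq (exec_move (x := rk) (by decide) rfl) ?_ (by simpa [rk] using len_k)
    funext j; cases j <;> simp [Store.fn, m₁₂, m₁₁, m₁₀, m₉, m₈, m₇, m₆, m₅, m₄]
  let m₁₃ : Store := { m₁₂ with
    res := []
    out := rk ++ m₁₁.out }
  have s₁₃ : Exec R (move .res .out) m₁₂.fn m₁₃.fn (2 * n + 1) := by
    refine Exec.of_eq (exec_move (x := rk.reverse) (by decide) rfl) ?_ (by simpa [rk] using len_k)
    funext j; cases j <;> simp [Store.fn, m₁₃, m₁₂]
  let m₁₄ : Store := { m₁₃ with out := none :: m₁₃.out }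
  have s₁₄ : Exec R (.push .out none) m₁₃.fn m₁₄.fn 1 := by
    refine Exec.of_eq Exec.push ?_ le_rfl
    funext j; cases j <;> simp [Store.fn, m₁₄]
  have s₁₅ := exec_writeNetwork (R := R) n m₁₄ rfl rfl rfl rfl
  have s₁₆ := exec_writeScores (R := R) (matrixBits f) {m₁₄ with
    h1 := hot n n
    h2 := hot n n
    h3 := hot n n
    out := (networkCode n).reverse ++ m₁₄.out} rfl
  rw [length_matrixBits] at s₁₆
  have s₁₇ : ∀ (h : Stk) (s : Stk → List (Option Bool)), s h = hot n n →
      Exec R (clear h) s (update s h []) (2 * n + 1) := fun h s hs =>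
    (exec_clear hs).mono (by simp)
  refine (s₁.seq (s₂.seq (s₃.seq (s₄.seq (s₅.seq (s₆.seq (s₇.seq (s₈.seq (s₉.seq (s₁₀.seq
    (s₁₁.seq (s₁₂.seq (s₁₃.seq (s₁₄.seq (s₁₅.seq (s₁₆.seq ((s₁₇ .h1 _ rfl).seq
    ((s₁₇ .h2 _ rfl).seq (s₁₇ .h3 _ rfl))))))))))))))))))).of_eq ?_ le_rfl
  have hout : (encodeECSInstance (reduction I)).reverse =
      ((matrixBits f).flatMap scoreCode).reverse ++ ((networkCode n).reverse ++ m₁₄.out) := by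
    rw [encodeECSInstance_reduction, flatMap_matrixBits]
    simp only [networkCode, m₁₄, m₁₃, m₁₁, m₁₀, rk, hf, List.reverse_append, List.reverse_cons,
      List.append_assoc, List.cons_append, List.nil_append]
    rfl
  rw [hout]
  funext j; cases j <;> simp [Store.fn, m₁₄, m₁₃, m₁₂, m₁₁, m₁₀, m₉, m₈, m₇, m₆, m₅, m₄]

end ElectionControl

/-! ### Programs that read a seed plan, evaluate the chosen vertices and pad them. -/

namespace ElectionControl

open StackProgram Computability Function

variable {R : List (Option Bool) → List (Option Bool) → ℕ → Prop}

/-! ### Reading a seed plan -/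

/-- Reads a number and forgets it. -/
def skipNum : Prog Stk (Option Bool) := readNum .inp .tmp .ctl ;; clear .tmp

theorem exec_skipNum (l : List Bool) (r : List (Option Bool)) (m : Store)
    (h : m.inp = l.map some ++ none :: r) :
    Exec R skipNum m.fn {m with inp := r}.fn (7 * l.length + 6) := by
  refine ((exec_readNum (i := Stk.inp) (o := .tmp) (c := .ctl) (s := m.fn) (by decide) (by decide)
    (by decide) h rfl).seq (exec_clear (x := (l.map some).reverse) ?_)).of_eq ?_ ?_
  · simp [Store.fn]
  · funext j; cases j <;> simp [Store.fn]
  · simp; omega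

/-- Reads the code of a voter in a seed plan whose first symbol is given. -/
def readSeed : Option Bool → Prog Stk (Option Bool)
  | none => .push .adj (some false)
  | some _ => .pop .inp ;; skipNum ;; skipNum ;; .push .adj (some true)

/-- The values of the message are irrelevant and skipped; with at most two bits each, the two skips
cost `20` steps apiece, and one pop and one push make `42`. -/
theorem exec_readSeed_some (m₀ : Fin 2 → ℤ) (r : List (Option Bool)) (m : Store) (s : Bool)
    (h : m.inp = none :: ((encodeNats [Equiv.intEquivNat (m₀ 0)] ++
      encodeNats [Equiv.intEquivNat (m₀ 1)]) ++ r))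
    (hm : ∀ i, (encodeNat (Equiv.intEquivNat (m₀ i))).length ≤ 2) :
    Exec R (readSeed (some s)) m.fn {m with
      inp := r
      adj := some true :: m.adj}.fn 42 := by
  simp only [encodeNats_cons, encodeNats_nil, List.append_assoc, List.cons_append,
    List.nil_append] at h
  have h₁ := exec_skipNum (R := R) (encodeNat (Equiv.intEquivNat (m₀ 0)))
    ((encodeNat (Equiv.intEquivNat (m₀ 1))).map some ++ none :: r)
    {m with inp := m.inp.tail} (by rw [h]; rfl)
  have h₂ := exec_skipNum (R := R) (encodeNat (Equiv.intEquivNat (m₀ 1))) r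
    {m with inp := (encodeNat (Equiv.intEquivNat (m₀ 1))).map some ++ none :: r} rfl
  have := hm 0
  have := hm 1
  refine (Exec.pop.seq ((h₁.of_start_eq ?_).seq (h₂.seq Exec.push))).of_eq ?_ (by omega)
  · funext j; cases j <;> simp [Store.fn]
  · funext j; cases j <;> simp [Store.fn]

/-- Reads the codes of the voters in a seed plan. -/
def readPlan : Prog Stk (Option Bool) := .loop .inp readSeed

theorem exec_readPlan (l : List (Option (Fin (1 + 1) → ℤ))) (m : Store)
    (h : m.inp = l.flatMap seedCode)
    (hl : ∀ m₀, some m₀ ∈ l → ∀ i, (encodeNat (Equiv.intEquivNat (m₀ i))).length ≤ 2) :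
    Exec R readPlan m.fn {m with
      inp := []
      adj := (l.map fun x => some (Option.isSome x)).reverse ++ m.adj}.fn (43 * l.length + 1) := by
  induction l generalizing m with
  | nil =>
    refine (Exec.loop_nil (k := Stk.inp) (s := m.fn) h).of_eq ?_ le_rfl
    funext j
    cases j <;> simp [Store.fn, h]
  | cons x l ih =>
    have ih' := ih {m with
      inp := l.flatMap seedCode
      adj := some x.isSome :: m.adj} rfl fun m₀ h₀ => hl m₀ (List.mem_cons_of_mem _ h₀)
    cases x with
    | none =>
      have hb : Exec R (readSeed none) (update m.fn .inp (l.flatMap seedCode)) {m with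
          inp := l.flatMap seedCode
          adj := some false :: m.adj}.fn 1 := by
        refine Exec.of_eq Exec.push ?_ le_rfl
        funext j; cases j <;> simp [Store.fn]
      refine (Exec.loop_cons (k := Stk.inp) (s := m.fn) (by simpa [Store.fn, seedCode] using h) hb
        ih').of_eq (by simp) ?_
      simp only [List.length_cons]; omega
    | some m₀ =>
      have hb := exec_readSeed_some (R := R) m₀ (l.flatMap seedCode) {m with
        inp := none :: ((encodeNats [Equiv.intEquivNat (m₀ 0)] ++
          encodeNats [Equiv.intEquivNat (m₀ 1)]) ++ l.flatMap seedCode)} true rfl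
        (hl m₀ (by simp))
      refine (Exec.loop_cons (k := Stk.inp) (s := m.fn) (x := some true) (xs := none ::
        ((encodeNats [Equiv.intEquivNat (m₀ 0)] ++
          encodeNats [Equiv.intEquivNat (m₀ 1)]) ++ l.flatMap seedCode)) ?_ (hb.of_start_eq ?_)
        ih').of_eq (by simp) ?_
      · rw [List.flatMap_cons] at h
        refine h.trans ?_
        simp [seedCode, List.finRange_succ]
      · funext j; cases j <;> simp [Store.fn]
      · simp only [List.length_cons]; omega

/-! ### Evaluating bilinear forms -/

/-- The hits of `scan` in a square matrix. -/
def hits {n : ℕ} (ξ η : Fin n → Bool) (f : Fin n → Fin n → Bool) : List (Option Bool) :=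
  (List.finRange n).flatMap fun a => rowHits (List.finRange n) (ξ a) η (f a)

theorem hits_ne_nil {n : ℕ} {ξ η : Fin n → Bool} {f : Fin n → Fin n → Bool} :
    hits ξ η f ≠ [] ↔ ∃ a b, ξ a ∧ η b ∧ f a b := by
  simp only [hits, rowHits, ne_eq, List.flatMap_eq_nil_iff, List.mem_finRange, true_implies]
  push Not
  refine exists_congr fun a => exists_congr fun b => ?_
  split_ifs with h <;> simp_all

theorem length_rowHits_le {β : Type*} (l : List β) (a : Bool) (η σ : β → Bool) :
    (rowHits l a η σ).length ≤ l.length := by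
  induction l with
  | nil => simp [rowHits]
  | cons b l ih =>
    simp only [rowHits, List.flatMap_cons, List.length_append, List.length_cons] at ih ⊢
    split_ifs <;> simp only [List.length_cons, List.length_nil] <;> omega

theorem length_hits_le {n : ℕ} (ξ η : Fin n → Bool) (f : Fin n → Fin n → Bool) :
    (hits ξ η f).length ≤ n * n :=
  length_flatMap_finRange_le fun _ => (length_rowHits_le _ _ _ _).trans (by simp)

theorem exec_scan_matrix {n : ℕ} {x tx y ty m w z : Stk} (hnd : [x, tx, y, ty, m, w, z].Nodup)
    {ξ η : Fin n → Bool} {f : Fin n → Fin n → Bool}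
    {s : Stk → List (Option Bool)} (hx : s x = (List.finRange n).map fun a => some (ξ a))
    (htx : s tx = []) (hy : s y = (List.finRange n).map fun b => some (η b)) (hty : s ty = [])
    (hm : s m = (matrixBits f).map some) (hw : s w = []) :
    Exec R (scan x tx y ty m w z) s (update s z ((hits ξ η f).reverse ++ s z))
      (n * (10 * n + 6) + 3) := by
  rw [map_matrixBits] at hm
  exact (exec_scan hnd hx htx hy hty hm hw).mono (by simp)

/-- Extracts the diagonal of the matrix on the stack `bits`. -/
def diagonal : Prog Stk (Option Bool) :=
  each .u .t0 fun _ => scan .h1 .t1 .h2 .t2 .bits .adj .acc ;; flush .acc .res ;;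
    shift (some false) .h1 .t1 ;; shift (some false) .h2 .t2

/-- With the same one-hot vector on both sides, the bilinear form picks out a diagonal entry. -/
theorem exec_diagonal {n : ℕ} (f : Fin n → Fin n → Bool) (m : Store)
    (hu : m.u = List.replicate n (some true)) (h₁ : m.h1 = hot n 0) (h₂ : m.h2 = hot n 0)
    (hb : m.bits = (matrixBits f).map some) (ha : m.adj = []) :
    Exec R diagonal m.fn {m with
      h1 := hot n n
      h2 := hot n n
      res := ((List.finRange n).map fun a => some (f a a)).reverse ++ m.res}.fn
      (n * (n * (10 * n + 6) + 2 * (n * n) + 8 * n + 18) + 2) := by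
  refine (exec_each (ξ := fun _ => some true) (l := List.finRange n)
    (C := n * (10 * n + 6) + 2 * (n * n) + 8 * n + 14)
    (S := fun l₁ _ => {m with
      h1 := hot n l₁.length
      h2 := hot n l₁.length
      res := (l₁.map fun a => some (f a a)).reverse ++ m.res}.fn)
    (by decide) ?_ ?_ ?_ rfl ?_ rfl ?_).mono (by simp)
  · funext j; cases j <;> simp [Store.fn, h₁, h₂]
  · funext j; cases j <;> simp [Store.fn]
  · simpa [Store.fn] using hu
  · simpa [Store.fn] using hu
  · intro l₁ a l₂ hl x y
    have hl' := length_of_finRange_eq hl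
    have hn : n ≠ 0 := Nat.ne_of_gt (lt_of_le_of_lt (Nat.zero_le _) a.2)
    rw [List.length_append, hl']
    let δ : Fin n → Bool := fun j => decide (j.1 = a.1)
    have hd : decide ((hits δ δ f).reverse ≠ []) = f a a := by
      rw [Bool.eq_iff_iff, decide_eq_true_iff, ne_eq, List.reverse_eq_nil_iff, ← ne_eq,
        hits_ne_nil]
      simp [δ, ← Fin.ext_iff]
    have hlen := length_hits_le δ δ f
    refine ((exec_scan_matrix (ξ := δ) (η := δ) (f := f) (by decide) ?_ ?_ ?_ ?_ ?_ ?_).seq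
      ((exec_flush (x := (hits δ δ f).reverse) (by decide) ?_).seq
      ((exec_shift_hot (n := n) (i := a.1) ?_ hn ?_ ?_).seq
        (exec_shift_hot (n := n) (i := a.1) ?_ hn ?_ ?_)))).of_eq ?_ ?_
    · simp [Store.fn, hot, δ]
    · simp [Store.fn]
    · simp [Store.fn, hot, δ]
    · simp [Store.fn]
    · simp [Store.fn, hb]
    · simp [Store.fn, ha]
    · simp [Store.fn]
    · decide
    · simp [Store.fn]
    · simp [Store.fn]
    · decide
    · simp [Store.fn]
    · simp [Store.fn]
    · rw [hd]
      funext j; cases j <;> simp [Store.fn]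
    · simp only [List.length_reverse]; omega

/-- For each `v`, decides whether column `v` of the matrix on the stack `bits` has an entry `true`
or row `v` and the stack `h3` have a common one. -/
def rowsAndColumns : Prog Stk (Option Bool) :=
  each .u .t0 fun _ => scan .h1 .t1 .h3 .t3 .bits .adj .acc ;;
    scan .h2 .t2 .h1 .t1 .bits .adj .acc ;; flush .acc .res ;; shift (some false) .h1 .t1

/-- Both clauses are bilinear forms: the all-ones vector against the one-hot vector of `v` inspects
a column, and the one-hot vector against `d` inspects a row. Both scans record on the same `acc`,
which computes the disjunction. -/
theorem exec_rowsAndColumns {n : ℕ} (f : Fin n → Fin n → Bool) (d : Fin n → Bool) (m : Store)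
    (hu : m.u = List.replicate n (some true)) (h₁ : m.h1 = hot n 0)
    (h₂ : m.h2 = List.replicate n (some true))
    (h₃ : m.h3 = (List.finRange n).map fun a => some (d a))
    (hb : m.bits = (matrixBits f).map some) (ha : m.adj = []) :
    Exec R rowsAndColumns m.fn {m with
      h1 := hot n n
      res := ((List.finRange n).map fun v =>
        some (decide ((∃ a, f a v) ∨ ∃ b, f v b ∧ d b))).reverse ++ m.res}.fn
      (n * (2 * (n * (10 * n + 6)) + 4 * (n * n) + 4 * n + 17) + 2) := by
  refine (exec_each (ξ := fun _ => some true) (l := List.finRange n)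
    (C := 2 * (n * (10 * n + 6)) + 4 * (n * n) + 4 * n + 13)
    (S := fun l₁ _ => {m with
      h1 := hot n l₁.length
      res := (l₁.map fun v =>
        some (decide ((∃ a, f a v) ∨ ∃ b, f v b ∧ d b))).reverse ++ m.res}.fn)
    (by decide) ?_ ?_ ?_ rfl ?_ rfl ?_).mono (by simp)
  · funext j; cases j <;> simp [Store.fn, h₁]
  · funext j; cases j <;> simp [Store.fn]
  · simpa [Store.fn] using hu
  · simpa [Store.fn] using hu
  · intro l₁ v l₂ hl x y
    have hl' := length_of_finRange_eq hl
    have hn : n ≠ 0 := Nat.ne_of_gt (lt_of_le_of_lt (Nat.zero_le _) v.2)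
    rw [List.length_append, hl']
    let δ : Fin n → Bool := fun j => decide (j.1 = v.1)
    let w : List (Option Bool) := (hits (fun _ => true) δ f).reverse ++ (hits δ d f).reverse
    have hd : decide (w ≠ []) = decide ((∃ a, f a v) ∨ ∃ b, f v b ∧ d b) := by
      rw [decide_eq_decide, ne_eq, List.append_eq_nil_iff, not_and_or, List.reverse_eq_nil_iff,
        List.reverse_eq_nil_iff, ← ne_eq, ← ne_eq, hits_ne_nil, hits_ne_nil]
      simp [δ, ← Fin.ext_iff, and_comm]
    have hlen₁ := length_hits_le δ d f
    have hlen₂ := length_hits_le (fun _ => true) δ f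
    refine ((exec_scan_matrix (ξ := δ) (η := d) (f := f) (by decide) ?_ ?_ ?_ ?_ ?_ ?_).seq
      ((exec_scan_matrix (ξ := fun _ => true) (η := δ) (f := f) (by decide) ?_ ?_ ?_ ?_ ?_ ?_).seq
      ((exec_flush (x := w) (by decide) ?_).seq
      (exec_shift_hot (n := n) (i := v.1) ?_ hn ?_ ?_)))).of_eq ?_ ?_
    · simp [Store.fn, hot, δ]
    · simp [Store.fn]
    · simp [Store.fn, h₃]
    · simp [Store.fn]
    · simp [Store.fn, hb]
    · simp [Store.fn, ha]
    · simp [Store.fn, h₂]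
    · simp [Store.fn]
    · simp [Store.fn, hot, δ]
    · simp [Store.fn]
    · simp [Store.fn, hb]
    · simp [Store.fn, ha]
    · simp [Store.fn, w]
    · decide
    · simp [Store.fn]
    · simp [Store.fn]
    · rw [hd]
      funext j; cases j <;> simp [Store.fn]
    · simp only [w, List.length_append, List.length_reverse]; omega

/-! ### Padding and writing the set of vertices -/

/-- Removes from the stack `uk` as many symbols as there are bits `true` on the stack `res`. -/
def countChosen : Prog Stk (Option Bool) :=
  each .res .t0 fun x => if x = some true then .pop .uk else .skip

/-- Popping an empty stack does nothing, in agreement with truncated subtraction. -/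
theorem exec_countChosen (l : List Bool) (k : ℕ) (m : Store) (hr : m.res = l.map some)
    (hk : m.uk = List.replicate k (some true)) :
    Exec R countChosen m.fn {m with uk := List.replicate (k - l.count true) (some true)}.fn
      (5 * l.length + 2) := by
  refine Exec.mono (exec_each (k := Stk.res) (t := .t0) (ξ := some) (l := l) (C := 1)
    (S := fun l₁ _ => {m with uk := List.replicate (k - l₁.count true) (some true)}.fn)
    (by decide) ?_ rfl hr rfl hr rfl ?_) (by omega)
  · funext j; cases j <;> simp [Store.fn, hk]
  · intro l₁ b l₂ hl x y
    cases b with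
    | true =>
      rw [if_pos rfl]
      refine Exec.of_eq Exec.pop ?_ le_rfl
      funext j; cases j <;> simp [Store.fn, Nat.sub_sub]
    | false =>
      rw [if_neg (by simp)]
      refine Exec.of_eq Exec.skip ?_ le_rfl
      funext j; cases j <;> simp [Store.fn]

/-- Pads one bit. -/
def padBit (x : Option Bool) : Prog Stk (Option Bool) :=
  if x = some true then .push .adj (some true) else .branch .uk fun
    | none => .push .adj (some false)
    | some _ => .pop .uk ;; .push .adj (some true)

/-- Pads the bits on the stack `bits`. -/
def pad : Prog Stk (Option Bool) := .loop .bits padBit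

/-- How many symbols are left on `uk` is immaterial, as that stack is cleared later; only an upper
bound for the clearing time is recorded. -/
theorem exec_pad (l : List Bool) (r : ℕ) (m : Store) (hb : m.bits = l.map some)
    (hr : m.uk = List.replicate r (some true)) :
    ∃ r' ≤ r, Exec R pad m.fn {m with
      bits := []
      uk := List.replicate r' (some true)
      adj := ((padBits r l).map some).reverse ++ m.adj}.fn (4 * l.length + 1) := by
  induction l generalizing m r with
  | nil =>
    refine ⟨r, le_rfl, (Exec.loop_nil (k := Stk.bits) (s := m.fn) hb).of_eq ?_ le_rfl⟩
    funext j
    cases j <;> simp [Store.fn, hb, hr, padBits]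
  | cons b l ih =>
    have key : ∀ (c : Bool) (q : ℕ), q ≤ r → padBits r (b :: l) = c :: padBits q l →
        Exec R (padBit (some b)) (update m.fn .bits (l.map some)) {m with
          bits := l.map some
          uk := List.replicate q (some true)
          adj := some c :: m.adj}.fn 3 →
        ∃ r' ≤ r, Exec R pad m.fn {m with
          bits := []
          uk := List.replicate r' (some true)
          adj := ((padBits r (b :: l)).map some).reverse ++ m.adj}.fn
          (4 * (b :: l).length + 1) := by
      intro c q hq hp h
      obtain ⟨r', hr', h'⟩ := ih q {m with
        bits := l.map some
        uk := List.replicate q (some true)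
        adj := some c :: m.adj} rfl rfl
      refine ⟨r', hr'.trans hq, (Exec.loop_cons (k := Stk.bits) (s := m.fn) hb h h').of_eq ?_ ?_⟩
      · simp [hp]
      · simp only [List.length_cons]; omega
    cases b with
    | true =>
      refine key true r le_rfl (by cases r <;> rfl) ?_
      refine Exec.of_eq Exec.push ?_ (by omega)
      funext j; cases j <;> simp [Store.fn, hr]
    | false =>
      cases r with
      | zero =>
        refine key false 0 le_rfl rfl ?_
        refine Exec.mono (Exec.branch (t := 1) ?_) (by omega)
        have : (update m.fn Stk.bits (l.map some) Stk.uk).head? = none := by simp [Store.fn, hr]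
        rw [this]
        refine Exec.of_eq Exec.push ?_ le_rfl
        funext j; cases j <;> simp [Store.fn, hr]
      | succ r =>
        refine key true r (by omega) rfl ?_
        refine Exec.branch (t := 2) ?_
        have : (update m.fn Stk.bits (l.map some) Stk.uk).head? = some (some true) := by
          simp [Store.fn, hr, List.replicate_succ]
        rw [this]
        refine (Exec.pop.seq Exec.push).of_eq ?_ le_rfl
        funext j; cases j <;> simp [Store.fn, hr]

/-- Writes the bits on the stack `adj`. -/
def writeBits : Prog Stk (Option Bool) :=
  .loop .adj fun x => .push .out none ;; if x = some true then .push .out (some true) else .skip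

/-- The final output must have its first symbol on top, so it is built from its end and each
separator is pushed before its bit. -/
theorem exec_writeBits (l : List Bool) (m : Store) (h : m.adj = l.map some) :
    Exec R writeBits m.fn {m with
      adj := []
      out := l.reverse.flatMap bitCode ++ m.out}.fn (3 * l.length + 1) := by
  induction l generalizing m with
  | nil =>
    refine (Exec.loop_nil (k := Stk.adj) (s := m.fn) h).of_eq ?_ le_rfl
    funext j
    cases j <;> simp [Store.fn, h]
  | cons b l ih =>
    have ih' := ih {m with
      adj := l.map some
      out := bitCode b ++ m.out} rfl
    have hb : Exec R (.push .out none ;; if some b = some true then .push .out (some true)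
        else .skip) (update m.fn .adj (l.map some)) {m with
          adj := l.map some
          out := bitCode b ++ m.out}.fn 2 := by
      cases b with
      | true =>
        rw [if_pos rfl]
        refine (Exec.push.seq Exec.push).of_eq ?_ le_rfl
        funext j; cases j <;> simp [Store.fn, bitCode]
      | false =>
        rw [if_neg (by simp)]
        refine (Exec.push.seq Exec.skip).of_eq ?_ le_rfl
        funext j; cases j <;> simp [Store.fn, bitCode]
    refine (Exec.loop_cons (k := Stk.adj) (s := m.fn) h hb ih').of_eq ?_ ?_
    · simp
    · simp only [List.length_cons]; omega

end ElectionControl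

/-! ### From a seed plan to the code of a vertex set. -/

namespace ElectionControl

open StackProgram Computability Function

variable {R : List (Option Bool) → List (Option Bool) → ℕ → Prop}

/-! ### Extracting the set of vertices from a seed plan -/

/-- The entries `0`, `1`, `-1` are coded by `0`, `2`, `1`. -/
theorem SeedPlan.IsSingleNews.length_encodeNat_le {ℓ n : ℕ} {P : SeedPlan ℓ n}
    (hP : P.IsSingleNews) {s : Fin n} {m : Fin (ℓ + 1) → ℤ} (hs : P s = some m) (i : Fin (ℓ + 1)) :
    (encodeNat (Equiv.intEquivNat (m i))).length ≤ 2 := by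
  obtain ⟨j, q, hq, h⟩ := hP
  refine (StackProgram.length_encodeNat_le _).trans ?_
  rw [h s m hs, Pi.single_apply]
  rcases hq with rfl | rfl <;> split_ifs <;> decide

theorem length_encodeSeedPlan_le {n : ℕ} {P : SeedPlan 1 n} (hP : P.IsSingleNews) :
    (encodeSeedPlan ⟨n, P⟩).length ≤ 9 * n + 1 := by
  have h₁ := StackProgram.length_encodeNat_le n
  have h₂ : ((List.finRange n).flatMap fun s => seedCode (P s)).length ≤ n * 8 := by
    refine length_flatMap_finRange_le fun s => ?_
    cases hs : P s with
    | none => simp [seedCode]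
    | some m =>
      have h₀ := hP.length_encodeNat_le hs 0
      have h₁ := hP.length_encodeNat_le hs 1
      simp [seedCode, List.finRange_succ, encodeNats_cons, encodeNats_nil]
      omega
  rw [encodeSeedPlan_eq]
  simp only [List.length_append, List.length_map, List.length_cons]
  omega

/-- Turns the code of a seed plan on the stack `res` into the code of a set of vertices on the
stack `out`. -/
def extractionProg : Prog Stk (Option Bool) :=
  move .res .inp ;; skipNum ;; readPlan ;; move .adj .bits ;;
  initHot .u .t0 .h1 ;; initHot .u .t0 .h2 ;; diagonal ;; move .res .h3 ;; clear .h1 ;; clear .h2 ;;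
  initHot .u .t0 .h1 ;; each .u .t0 (fun _ => .push .h2 (some true)) ;; rowsAndColumns ;;
  clear .bits ;; countChosen ;; move .res .bits ;; pad ;; writeBits ;; .push .out none ;;
  move .nR .out ;; clear .u ;; clear .uk ;; clear .h1 ;; clear .h2 ;; clear .h3

/-- The running time of `extractionProg`. -/
def extractionTime {A : Type*} [CommSemiring A] (n : A) : A :=
  2 * (9 * (n * n) + 1) + 1 + (7 * (n * n) + 6 + (43 * (n * n) + 1 + (2 * (n * n) + 1 +
  (5 * n + 5 + (5 * n + 5 + (n * (n * (10 * n + 6) + 2 * (n * n) + 8 * n + 18) + 2 +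
  (2 * n + 1 + (2 * n + 1 + (2 * n + 1 + (5 * n + 5 + (n * 5 + 2 +
  (n * (2 * (n * (10 * n + 6)) + 4 * (n * n) + 4 * n + 17) + 2 +
  (2 * (n * n) + 1 + (5 * n + 2 + (2 * n + 1 + (4 * n + 1 + (3 * n + 1 + (1 + (2 * n + 1 +
  (2 * n + 1 + (2 * n + 1 + (2 * n + 1 + (2 * n + 1 + (2 * n + 1))))))))))))))))))))))))

theorem exec_extractionProg (I : DkSInstance) {P : SeedPlan 1 (reduction I).n}
    (hP : P.IsSingleNews) :
    Exec R extractionProg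
      { nR := ((encodeNat I.n).map some).reverse
        u := List.replicate I.n (some true)
        uk := List.replicate I.k (some true)
        res := (encodeSeedPlan ⟨(reduction I).n, P⟩).reverse : Store }.fn
      {out := encodeVertexSet ⟨I.n, finalSet P⟩ : Store}.fn (extractionTime I.n) := by
  classical
  have hk := I.k_le
  set n := I.n with hn
  set k := I.k with hk'
  let f : Fin n → Fin n → Bool := fun a b => (P (voter a b)).isSome
  have len_n := length_encodeNat_le n
  have len_N := length_encodeNat_le (n * n)
  set rn := ((encodeNat n).map some).reverse with hrn
  let T : List (Option Bool) := List.replicate n (some true)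
  let Tk : List (Option Bool) := List.replicate k (some true)
  -- The same plan, with the number of voters unfolded so that `flatMap_finRange_mul` applies.
  let Q : Fin (n * n) → Option (Fin (1 + 1) → ℤ) := P
  have hplan : encodeSeedPlan ⟨(reduction I).n, P⟩ = (encodeNat (n * n)).map some ++ none ::
      ((List.finRange (n * n)).map Q).flatMap seedCode := by
    rw [List.flatMap_map]
    exact encodeSeedPlan_eq P
  have hlen : (encodeSeedPlan ⟨(reduction I).n, P⟩).length ≤ 9 * (n * n) + 1 :=
    length_encodeSeedPlan_le hP
  set plan := encodeSeedPlan ⟨(reduction I).n, P⟩ with hplan'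
  have hbits : ((List.finRange (n * n)).map Q).map (fun x => some x.isSome) =
      (matrixBits f).map some := by
    rw [map_matrixBits, List.map_map, List.map_eq_flatMap, flatMap_finRange_mul]
    refine List.flatMap_congr fun a _ => ?_
    rw [List.map_eq_flatMap]
    rfl
  let m₀ : Store := { nR := rn, u := T, uk := Tk, res := plan.reverse }
  let m₁ : Store := { nR := rn, u := T, uk := Tk, inp := plan }
  have s₁ : Exec R (move .res .inp) m₀.fn m₁.fn (2 * (9 * (n * n) + 1) + 1) := by
    refine Exec.of_eq (exec_move (x := plan.reverse) (by decide) rfl) ?_ (by simpa using hlen)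
    funext j; cases j <;> simp [Store.fn, m₀, m₁]
  have s₂ := (exec_skipNum (R := R) (encodeNat (n * n)) _ m₁ hplan).mono
    (t' := 7 * (n * n) + 6) (by omega)
  have s₃ := exec_readPlan (R := R) ((List.finRange (n * n)).map Q)
    { m₁ with inp := ((List.finRange (n * n)).map Q).flatMap seedCode } rfl (by
      intro m hm
      obtain ⟨s, -, hs⟩ := List.mem_map.1 hm
      exact hP.length_encodeNat_le hs)
  rw [List.length_map, List.length_finRange, hbits] at s₃
  let m₄ : Store := { nR := rn, u := T, uk := Tk, bits := (matrixBits f).map some }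
  have s₄ : Exec R (move .adj .bits) { m₁ with
      inp := []
      adj := ((matrixBits f).map some).reverse ++ [] }.fn m₄.fn (2 * (n * n) + 1) := by
    refine Exec.of_eq (exec_move (x := ((matrixBits f).map some).reverse ++ []) (by decide) rfl) ?_
      (by simp)
    funext j; cases j <;> simp [Store.fn, m₄, m₁]
  have hot' : ∀ (h : Stk) (m : Store), m.u = T → .u ≠ h → .t0 ≠ h → m.fn h = [] →
      Exec R (initHot .u .t0 h) m.fn (update m.fn h (hot n 0)) (5 * n + 5) :=
    fun h m hu h₁ h₂ h₃ => exec_initHot (by decide) h₁ h₂ hu rfl h₃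
  let m₅ : Store := { m₄ with h1 := hot n 0 }
  have s₅ : Exec R (initHot .u .t0 .h1) m₄.fn m₅.fn (5 * n + 5) := by
    refine Exec.of_eq (hot' .h1 m₄ rfl (by decide) (by decide) rfl) ?_ le_rfl
    funext j; cases j <;> simp [Store.fn, m₅]
  let m₆ : Store := { m₅ with h2 := hot n 0 }
  have s₆ : Exec R (initHot .u .t0 .h2) m₅.fn m₆.fn (5 * n + 5) := by
    refine Exec.of_eq (hot' .h2 m₅ rfl (by decide) (by decide) rfl) ?_ le_rfl
    funext j; cases j <;> simp [Store.fn, m₆]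
  have s₇ := exec_diagonal (R := R) f m₆ rfl rfl rfl rfl rfl
  let d : Fin n → Bool := fun a => f a a
  let m₈ : Store := { m₆ with
    h1 := hot n n
    h2 := hot n n
    h3 := (List.finRange n).map fun a => some (d a) }
  have s₈ : Exec R (move .res .h3) { m₆ with
      h1 := hot n n
      h2 := hot n n
      res := ((List.finRange n).map fun a => some (f a a)).reverse ++ [] }.fn m₈.fn
      (2 * n + 1) := by
    refine Exec.of_eq (exec_move (x := ((List.finRange n).map fun a => some (f a a)).reverse ++ [])
      (by decide) rfl) ?_ (by simp)
    funext j; cases j <;> simp [Store.fn, m₈, m₆, m₅, m₄, d]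
  have clr : ∀ (h : Stk) (s : Stk → List (Option Bool)), (s h).length ≤ n →
      Exec R (clear h) s (update s h []) (2 * n + 1) := fun h s hs =>
    (exec_clear rfl).mono (by omega)
  let m₁₀ : Store := { m₈ with
    h1 := []
    h2 := [] }
  have s₁₀ : Exec R (clear .h2) (update m₈.fn .h1 []) m₁₀.fn (2 * n + 1) := by
    refine Exec.of_eq (clr .h2 _ (by simp [Store.fn, m₈])) ?_ le_rfl
    funext j; cases j <;> simp [Store.fn, m₁₀]
  let m₁₁ : Store := { m₁₀ with h1 := hot n 0 }
  have s₁₁ : Exec R (initHot .u .t0 .h1) m₁₀.fn m₁₁.fn (5 * n + 5) := by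
    refine Exec.of_eq (hot' .h1 m₁₀ rfl (by decide) (by decide) rfl) ?_ le_rfl
    funext j; cases j <;> simp [Store.fn, m₁₁]
  let m₁₂ : Store := { m₁₁ with h2 := T }
  have s₁₂ : Exec R (each .u .t0 (fun _ => .push .h2 (some true))) m₁₁.fn m₁₂.fn
      (n * 5 + 2) := by
    refine Exec.of_eq (exec_each_push (x := T) (g := fun _ => some true) (by decide) (by decide)
      (by decide) rfl rfl) ?_ (by simp [T])
    funext j; cases j <;> simp [Store.fn, m₁₂, m₁₁, m₁₀, T]
  have s₁₃ := exec_rowsAndColumns (R := R) f d m₁₂ rfl rfl rfl rfl rfl rfl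
  -- As `d` is the diagonal of `f`, the computed bits are literally the definition of `chosen`.
  have hch : ((List.finRange n).map fun v =>
      some (decide ((∃ a, f a v) ∨ ∃ b, f v b ∧ d b))).reverse ++ m₁₂.res =
      (chosenBits P).reverse.map some := by
    rw [← List.map_reverse, chosenBits, ← List.map_reverse, List.map_map]
    refine (List.append_nil _).trans (List.map_congr_left fun v _ => ?_)
    simp only [comp_apply, Option.some_inj, decide_eq_decide, chosen, Finset.mem_filter,
      Finset.mem_univ, true_and, SeedPlan.mem_seeds]
    rfl
  rw [hch] at s₁₃
  have len_b : (chosenBits P).length = n := by simp [chosenBits, hn]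
  have len_f := length_finalBits P
  let m₁₄ : Store := { m₁₂ with
    h1 := hot n n
    bits := []
    res := (chosenBits P).reverse.map some }
  have s₁₄ : Exec R (clear .bits) { m₁₂ with
      h1 := hot n n
      res := (chosenBits P).reverse.map some }.fn m₁₄.fn (2 * (n * n) + 1) := by
    refine Exec.of_eq (exec_clear (x := (matrixBits f).map some) rfl) ?_ (by simp)
    funext j; cases j <;> simp [Store.fn, m₁₄]
  have s₁₅ := exec_countChosen (R := R) (chosenBits P).reverse k m₁₄ rfl rfl
  rw [List.length_reverse, len_b, List.count_reverse] at s₁₅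
  let m₁₆ : Store := { m₁₄ with
    uk := List.replicate (k - (chosenBits P).count true) (some true)
    res := []
    bits := (chosenBits P).map some }
  have s₁₆ : Exec R (move .res .bits) { m₁₄ with
      uk := List.replicate (k - (chosenBits P).count true) (some true) }.fn m₁₆.fn
      (2 * n + 1) := by
    refine Exec.of_eq (exec_move (x := (chosenBits P).reverse.map some) (by decide) rfl) ?_
      (by simp [len_b])
    funext j; cases j <;> simp [Store.fn, m₁₆, m₁₄]
  obtain ⟨r, hr, s₁₇⟩ := exec_pad (R := R) (chosenBits P)
    (k - (chosenBits P).count true) m₁₆ rfl rfl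
  rw [len_b, show padBits (k - (chosenBits P).count true) (chosenBits P) = finalBits P from rfl]
    at s₁₇
  let m₁₇ : Store := { m₁₆ with
    bits := []
    uk := List.replicate r (some true)
    adj := ((finalBits P).map some).reverse ++ [] }
  have s₁₈ := exec_writeBits (R := R) (finalBits P).reverse m₁₇ (by simp [m₁₇])
  rw [List.length_reverse, len_f, List.reverse_reverse] at s₁₈
  let m₁₈ : Store := { m₁₇ with
    adj := []
    out := (finalBits P).flatMap bitCode ++ [] }
  let m₁₉ : Store := { m₁₈ with out := none :: m₁₈.out }
  have s₁₉ : Exec R (.push .out none) m₁₈.fn m₁₉.fn 1 := by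
    refine Exec.of_eq Exec.push ?_ le_rfl
    funext j; cases j <;> simp [Store.fn, m₁₉]
  let m₂₀ : Store := { m₁₉ with
    nR := []
    out := encodeVertexSet ⟨I.n, finalSet P⟩ }
  have s₂₀ : Exec R (move .nR .out) m₁₉.fn m₂₀.fn (2 * n + 1) := by
    refine Exec.of_eq (exec_move (x := rn) (by decide) rfl) ?_ (by simpa [rn] using len_n)
    funext j; cases j <;> simp [Store.fn, m₂₀, m₁₉, m₁₈, rn, encodeVertexSet_finalSet, hn]
  have hrn' : r ≤ n := by omega
  refine (s₁.seq (s₂.seq (s₃.seq (s₄.seq (s₅.seq (s₆.seq (s₇.seq (s₈.seq ((clr .h1 _ ?_).seq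
    (s₁₀.seq (s₁₁.seq (s₁₂.seq (s₁₃.seq (s₁₄.seq (s₁₅.seq (s₁₆.seq (s₁₇.seq (s₁₈.seq (s₁₉.seq
    (s₂₀.seq ((clr .u _ ?_).seq ((clr .uk _ ?_).seq ((clr .h1 _ ?_).seq ((clr .h2 _ ?_).seq
    (clr .h3 _ ?_))))))))))))))))))))))))).of_eq ?_ le_rfl
  · exact (length_hot n n).le
  · exact (List.length_replicate (n := n)).le
  · exact (List.length_replicate (n := r)).le.trans hrn'
  · exact (length_hot n n).le
  · exact (List.length_replicate (n := n)).le
  · simp [Store.fn, m₂₀, m₁₉, m₁₈, m₁₇, m₁₆, m₁₄, m₁₂, m₁₁, m₁₀, m₈]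
  · funext j
    cases j <;> simp [Store.fn, m₂₀, m₁₉, m₁₈, m₁₇, m₁₆, m₁₄, m₁₂, m₁₁, m₁₀, m₈, m₆, m₅, m₄]

end ElectionControl

/-! ### The polynomial time bound and the final assembly. -/

namespace ElectionControl

open StackProgram Computability Function Turing

/-! ### The running time -/

/-- Coefficients in `ℕ` make every polynomial monotone, so lengths may be replaced by upper bounds
inside time bounds. -/
theorem eval_le_eval (p : Polynomial ℕ) {a b : ℕ} (h : a ≤ b) : p.eval a ≤ p.eval b := by
  rw [Polynomial.eval_eq_sum_range, Polynomial.eval_eq_sum_range]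
  gcongr

/-- A bound on the length of the code of an election that comes from a graph. -/
def codeLength {A : Type*} [CommSemiring A] (n : A) : A :=
  n * n + 1 + (n + 1 + (n * (n * (n * (n * 6))) + n * (n * 4)))

theorem length_scoreCode_le (b : Bool) : (scoreCode b).length ≤ 4 := by
  cases b <;> simp [scoreCode]

theorem length_encodeECSInstance_reduction_le (I : DkSInstance) :
    (encodeECSInstance (reduction I)).length ≤ codeLength I.n := by
  classical
  rw [encodeECSInstance_reduction]
  simp only [List.length_append, List.length_cons, List.length_map, codeLength]
  have h₁ := length_encodeNat_le (I.n * I.n)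
  have h₂ := (length_encodeNat_le I.k).trans I.k_le
  refine (?_ : _ ≤ I.n * I.n + (I.n + (I.n * (I.n * (I.n * (I.n * 6))) + I.n * (I.n * 4) + 1) + 1)
    ).trans (by omega)
  gcongr
  · exact length_flatMap_finRange_le fun a => length_flatMap_finRange_le fun b =>
      length_flatMap_finRange_le fun c => length_flatMap_finRange_le fun d => length_edgeCode_le _
  · exact length_flatMap_finRange_le fun a => length_flatMap_finRange_le fun b =>
      length_scoreCode_le _

/-- Each of the `n * n` matrix entries contributes at least its separator. Hence a polynomial in `n`
is a polynomial bound in the input length, although `n` itself is written in binary. -/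
theorem le_length_encodeDkSInstance (I : DkSInstance) : I.n ≤ (encodeDkSInstance I).length := by
  classical
  have h : ∀ b, 1 ≤ (bitCode b).length := by intro b; cases b <;> simp [bitCode]
  have h' : I.n * I.n ≤ ((matrixBits fun a b => decide (I.G.Adj a b)).flatMap bitCode).length := by
    rw [List.length_flatMap]
    refine le_trans ?_ (List.card_nsmul_le_sum _ 1 ?_)
    · simp
    · intro x hx
      obtain ⟨b, -, rfl⟩ := List.mem_map.1 hx
      exact h b
  rw [encodeDkSInstance_eq, ← flatMap_matrixBits]
  simp only [List.length_append, List.length_cons]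
  have := Nat.le_mul_self I.n
  omega

/-! ### The algorithm -/

/-- The algorithm for graphs that calls an algorithm for elections. -/
def algorithm : Prog Stk (Option Bool) := reductionProg ;; .call .out .res ;; extractionProg

/-- The running time of `algorithm` if the time of the call is `p`. -/
noncomputable def algorithmTime (p : Polynomial ℕ) : Polynomial ℕ :=
  reductionTime Polynomial.X + (codeLength Polynomial.X + p.comp (codeLength Polynomial.X) +
    (9 * (Polynomial.X * Polynomial.X) + 1) + 2 + extractionTime Polynomial.X) + 1

/-- The time formulas are stated over any commutative semiring, so the same expression serves as a
polynomial and as a number. -/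
theorem eval_algorithmTime (p : Polynomial ℕ) (n : ℕ) :
    (algorithmTime p).eval n = reductionTime n + (codeLength n + p.eval (codeLength n) +
      (9 * (n * n) + 1) + 2 + extractionTime n) + 1 := by
  simp [algorithmTime, reductionTime, extractionTime, codeLength]

theorem exec_algorithm {R : List (Option Bool) → List (Option Bool) → ℕ → Prop} (I : DkSInstance)
    {P : SeedPlan 1 (reduction I).n} (hP : P.IsSingleNews) {p : Polynomial ℕ}
    (hR : R (encodeECSInstance (reduction I)) (encodeSeedPlan ⟨(reduction I).n, P⟩)
      (p.eval (encodeECSInstance (reduction I)).length)) :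
    ∃ t, t + 1 ≤ (algorithmTime p).eval (encodeDkSInstance I).length ∧
      Exec R algorithm (update (fun _ => []) .inp (encodeDkSInstance I))
        (update (fun _ => []) .out (encodeVertexSet ⟨I.n, finalSet P⟩)) t := by
  have h₁ := exec_reductionProg (R := R) I
  have h₂ := exec_extractionProg (R := R) I hP
  have hlen := length_encodeECSInstance_reduction_le I
  have hlen' : (encodeSeedPlan ⟨(reduction I).n, P⟩).length ≤ 9 * (I.n * I.n) + 1 :=
    length_encodeSeedPlan_le hP
  have hp := eval_le_eval p hlen
  refine ⟨_, le_trans ?_ (eval_le_eval _ (le_length_encodeDkSInstance I)),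
    ((h₁.seq ((Exec.call (i := Stk.out) (o := .res) hR rfl).seq
      (h₂.of_start_eq ?_))).of_eq ?_ le_rfl).of_start_eq ?_⟩
  · rw [eval_algorithmTime]
    omega
  · funext j; cases j <;> simp [Store.fn]
  · funext j; cases j <;> simp [Store.fn]
  · funext j; cases j <;> simp [Store.fn]

/-- Feasibility of the answer is used twice: it bounds the number of chosen vertices by `k`, and it
keeps the code of the plan short enough to be read in polynomial time. -/
theorem dkSApproximable_of_ecsSingleNewsApproximable {ρ : ℝ} (hρ : 0 < ρ)
    (h : ECSSingleNewsApproximable 1 ρ) : DkSApproximable ρ := by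
  obtain ⟨A, hA, ⟨M⟩⟩ := h
  refine ⟨fun I => finalSet (A (reduction I)), fun I => ⟨card_finalSet (hA _).1, fun X hX =>
    density_finalSet hρ (hA _).1 (hA _).2 hX⟩, ?_⟩
  have key : ∀ I : DkSInstance, Nonempty (TM2OutputsInTime
      (machine M.tm M.inputAlphabet M.outputAlphabet algorithm .inp .out) (encodeDkSInstance I)
      (some (encodeVertexSet ⟨I.n, finalSet (A (reduction I))⟩))
      ((algorithmTime M.time).eval (encodeDkSInstance I).length)) := by
    intro I
    have hR : Outputs M.tm M.inputAlphabet M.outputAlphabet (encodeECSInstance (reduction I))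
        (encodeSeedPlan ⟨(reduction I).n, A (reduction I)⟩)
        (M.time.eval (encodeECSInstance (reduction I)).length) := by
      have o := M.outputsFun (reduction I)
      exact ⟨o.steps, o.steps_le_m, o.evals_in_steps⟩
    obtain ⟨t, ht, he⟩ := exec_algorithm I (hA _).1.1 hR
    obtain ⟨o⟩ := he.machine_outputs
    exact ⟨⟨o.toEvalsTo, o.steps_le_m.trans ht⟩⟩
  exact ⟨{
    tm := machine M.tm M.inputAlphabet M.outputAlphabet algorithm .inp .out
    inputAlphabet := Equiv.refl (Option Bool)
    outputAlphabet := Equiv.refl (Option Bool)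
    time := algorithmTime M.time
    outputsFun := fun I => by
      have o := (key I).some
      have e : ∀ l : List (Option Bool), l.map (Equiv.refl (Option Bool)).invFun = l :=
        fun l => List.map_id l
      refine ⟨⟨o.steps, ?_⟩, o.steps_le_m⟩
      refine Eq.trans ?_ (o.evals_in_steps.trans ?_)
      · exact congrArg (fun l => _) (congrArg some
          (congrArg (initList _) (e (encodeDkSInstance I))))
      · exact congrArg (fun l => _) (congrArg some
          (e (encodeVertexSet ⟨I.n, finalSet (A (reduction I))⟩)).symm) }⟩

end ElectionControl

theorem theorem4 :
    (∀ ρ : ℝ, 0 < ρ → ElectionControl.ECSSingleNewsApproximable 1 ρ →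
      ElectionControl.DkSApproximable ρ) ∧
    ((¬ ∃ ρ : ℝ, 0 < ρ ∧ ElectionControl.DkSApproximable ρ) →
      ¬ ∃ ρ : ℝ, 0 < ρ ∧ ElectionControl.ECSSingleNewsApproximable 1 ρ) :=
  ⟨fun _ hρ h => ElectionControl.dkSApproximable_of_ecsSingleNewsApproximable hρ h,
    fun hD ⟨ρ, hρ, h⟩ =>
      hD ⟨ρ, hρ, ElectionControl.dkSApproximable_of_ecsSingleNewsApproximable hρ h⟩⟩
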